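/- **Setting.** Let $f:\mathbb R^n\to\mathbb R$ be convex, differentiable and $L$-Lipschitz smooth ($L\ge 0$), i.e. $D_f(x,y):=f(x)-f(y)-\langle\nabla f(y),x-y\rangle\le\frac L2\|x-y\|^2$ for all $x,y$. Let $\omega:\mathbb R^m\to\mathbb R$ be convex and $K_\omega$-Lipschitz, $A\in\mathbb R^{m\times n}$, $g=\omega\circ A$, $F=f+g$, and let $\bar x$ be a minimizer of $F$. Write $\omega^\star$ for the Fenchel conjugate and, for $\epsilon\ge0$, $\partial_\epsilon\varphi(x)=\{s:\langle s,u-x\rangle\le\varphi(u)-\varphi(x)+\epsilon\ \forall u\}$. **Outer loop (IAPG).** Let $\alpha_k\in(0,1]$, $B_k>0$, $\rho_k\ge 0$, $\epsilon_k>0$, $L_k=B_k+\rho_k$ $(k\ge0)$, let $x_{-1},x_{-1}^\circ\in\mathbb R^n$, and suppose that for all $k\ge 0$ $$y_k=\alpha_kx_{k-1}^\circ+(1-\alpha_k)x_{k-1},\qquad \mathbf 0\in\nabla f(y_k)-L_k(y_k-x_k)+\partial_{\epsilon_k}g(x_k),$$ $$D_f(x_k,y_k)\le\tfrac{B_k}2\|x_k-y_k\|^2,\qquad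 x_k^\circ=x_{k-1}+\alpha_k^{-1}(x_k-x_{k-1}).$$ Assume the optimal momentum and error schedule: $\mathcal E_0>0$, $p>1$, $\alpha_0=1$, $1-\alpha_k=\dfrac{\alpha_k^2L_k}{\alpha_{k-1}^2L_{k-1}}$ for $k\ge1$; $0<L_{\min}\le L_k\le L_{\max}$ for all $k$; $\epsilon_0=\mathcal E_0$ and $\epsilon_k=\mathcal E_0\beta_kk^{-p}+\frac{\rho_k}2\|x_k-y_k\|^2$ for $k\ge1$, where $\beta_k=\prod_{i=1}^k\max\bigl(1-\alpha_i,\frac{\alpha_i^2L_i}{\alpha_{i-1}^2L_{i-1}}\bigr)$. **Inner loops.** For each $k$ put $\lambda=\lambda^{(k)}=L_k^{-1}$, $\tilde y_k=y_k-L_k^{-1}\nabla f(y_k)$, $h(x)=\frac1{2\lambda}\|\lambda x-\tilde y_k\|^2-\frac1{2\lambda}\|\tilde y_k\|^2$, and $$\Phi_k(u)=\omega(Au)+\tfrac1{2\lambda}\|u-\tilde y_k\|^2,\qquad \Psi_k(v)=h(A^\top v)+\omega^\star(v),\qquad \mathbf G_k(u,v)=\Phi_k(u)+\Psi_k(v).$$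 Let $v_0^{(k)}\in\operatorname{dom}\omega^\star$, $\tau_j^{(k)}>0$ and, for all $j\ge0$ (indices $k$ suppressed), $$v_{j+1}=\operatorname{prox}_{\tau_j^{-1}\omega^\star}\bigl(v_j-\tau_j^{-1}A\nabla h(A^\top v_j)\bigr),\quad D_{h\circ A^\top}(v_{j+1},v_j)\le\tfrac{\tau_j}2\|v_{j+1}-v_j\|^2,\quad z_j=\tilde y_k-\lambda A^\top v_j .$$ Assume that there are $\kappa_{\min}>0$ and $\bar\tau_{\max}$ with $\tau_j^{(k)}\le\bar\tau_{\max}$ for all $k,j$ such that each $\Psi_k$ has a minimizer and satisfies quadratic growth $\Psi_k(v)\ge\min\Psi_k+\frac{\kappa_k}2\operatorname{dist}^2(v\mid\operatorname{argmin}\Psi_k)$ for all $v$, with $\kappa_k\ge\kappa_{\min}$. Let $J_k$ be the smallest $j\ge0$ with $\mathbf G_k(z_j^{(k)},v_j^{(k)})\le\epsilon_k$, i.e. the number of inner iterations at outer step $k$. **Constants.** Let $\mathcal R_\infty=\mathcal E_0\bigl(1+\sum_{l\ge1}l^{-p}\bigr)$, $C_\Psi=\operatorname{diam}(\operatorname{dom}\omega^\star)$,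 $C_\lambda^{\max}=C_\Psi\bigl(2\|A\|K_\omega\sqrt{\bar\tau_{\max}/L_{\min}}+\frac12\bar\tau_{\max}C_\Psi\bigr)$, $$C_1=\tfrac12\sqrt{\tfrac{L_0}{L_{\max}}},\quad C_2=\tfrac{L_0}2\|\bar x-x_{-1}^\circ\|^2+\mathcal R_\infty,\quad C_3=\|\bar x-x_{-1}^\circ\|+\sqrt{\tfrac{2\mathcal R_\infty}{L_0}},\quad C_4=1+\tfrac{\kappa_{\min}}{\bar\tau_{\max}},\quad C_5=\frac{C_\lambda^{\max}C_4^{1/2}}{\mathcal E_0}\cdot\frac{L_0}{L_{\min}},$$ $$C_6=\Bigl\lceil \tfrac{\sqrt{C_2}}{C_1}\Bigr\rceil^2(4C_5)^{\frac2{2+p}},\quad C_7=\Bigl\lceil4C_3\sqrt{\tfrac{L_{\max}}{L_{\min}}}\Bigr\rceil(4C_5)^{\frac1{2+p}},\quad C_8=\Bigl\lceil4C_3\sqrt{\tfrac{L_{\max}}{L_{\min}}}(L+L_{\max})\Bigr\rceil(4C_5)^{\frac1{2+p}}.$$ **Theorem.** Every $J_k$ is finite (the gap $\mathbf G_k$ reaches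 $\epsilon_k$), and the following hold (terms with $\ln 0$, which occur only if $C_5=0$, are read as $0$). 1. For every $\varepsilon>0$ there is $k\ge0$ with $F(x_k)-F(\bar x)\le\varepsilon$ and $$\sum_{l=0}^kJ_l\le N_1(\varepsilon):=\Bigl(1+\Bigl\lceil \tfrac{\sqrt{C_2}\,\varepsilon^{-1/2}}{C_1}\Bigr\rceil\Bigr)\Bigl\lceil\max\Bigl(1,\tfrac{2\ln C_5}{\ln C_4},\tfrac{(2+p)\ln(\max(1,4\varepsilon^{-1})C_6)}{\ln C_4}\Bigr)\Bigr\rceil,$$ and $N_1(\varepsilon)=\mathcal O(\varepsilon^{-1/2}\ln(\varepsilon^{-1}))$ as $\varepsilon\downarrow0$. 2. For every $\varepsilon>0$ there is $k\ge0$ with $\|x_k-y_k\|\le\varepsilon$ and $$\sum_{l=0}^kJ_l\le N_2(\varepsilon):=\Bigl(1+\Bigl\lceil\tfrac{4C_3}{\varepsilon}\sqrt{\tfrac{L_{\max}}{L_{\min}}}\Bigr\rceil\Bigr)\Bigl\lceil\max\Bigl(1,\tfrac{2\ln C_5}{\ln C_4},\tfrac{2(2+p)\ln(\max(1,2\varepsilon^{-1})C_7)}{\ln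 C_4}\Bigr)\Bigr\rceil,$$ and $N_2(\varepsilon)=\mathcal O(\varepsilon^{-1}\ln(\varepsilon^{-1}))$ as $\varepsilon\downarrow0$. 3. For every $\varepsilon>0$ there is $k\ge0$ with $\operatorname{dist}(\mathbf 0\mid\partial_{\epsilon_k}F(x_k))\le\varepsilon$ (in particular this set is nonempty) and $$\sum_{l=0}^kJ_l\le N_3(\varepsilon):=\Bigl(1+\Bigl\lceil\tfrac{4C_3(L+L_{\max})}{\varepsilon}\sqrt{\tfrac{L_{\max}}{L_{\min}}}\Bigr\rceil\Bigr)\Bigl\lceil\max\Bigl(1,\tfrac{2\ln C_5}{\ln C_4},\tfrac{2(2+p)\ln(\max(1,2\varepsilon^{-1})C_8)}{\ln C_4}\Bigr)\Bigr\rceil,$$ and $N_3(\varepsilon)=\mathcal O(\varepsilon^{-1}\ln(\varepsilon^{-1}))$ as $\varepsilon\downarrow0$. -/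

import Mathlib

open Filter Topology Asymptotics

noncomputable section

/-- The Euclidean space `ℝⁿ`. An `m × n` matrix `A` is represented by the (automatically continuous)
linear map `Euc n →L[ℝ] Euc m` it induces; `‖A‖` is then its spectral norm and
`A.adjoint` is its transpose. -/
abbrev Euc (n : ℕ) : Type := EuclideanSpace ℝ (Fin n)

/-- The Bregman divergence `D_f(x, y) = f x - f y - ⟨∇f(y), x - y⟩`. -/
def bregman {n : ℕ} (f : Euc n → ℝ) (x y : Euc n) : ℝ :=
  f x - f y - inner ℝ (gradient f y) (x - y)

/-- `f` is convex, differentiable and `L`-Lipschitz smooth. -/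
structure IsLipschitzSmooth {n : ℕ} (f : Euc n → ℝ) (L : ℝ) : Prop where
  nonneg : 0 ≤ L
  convex : ConvexOn ℝ Set.univ f
  differentiable : Differentiable ℝ f
  descent : ∀ x y, bregman f x y ≤ L / 2 * ‖x - y‖ ^ 2

/-- The `ε`-subdifferential of a finite function `g` at `x`. -/
def epsSubdiff {n : ℕ} (g : Euc n → ℝ) (ε : ℝ) (x : Euc n) : Set (Euc n) :=
  {s | ∀ u, inner ℝ s (u - x) ≤ g u - g x + ε}

/-- `x' ≈_ε T_r(x)`: `x'` is an inexact proximal gradient point of `f + g`, that is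
`0 ∈ ∇f(x) - r (x - x') + ∂_ε g(x')`. -/
def IsInexactProxGrad {n : ℕ} (f g : Euc n → ℝ) (ε r : ℝ) (x x' : Euc n) : Prop :=
  ∃ s ∈ epsSubdiff g ε x', gradient f x - r • (x - x') + s = 0

/-- The Fenchel conjugate of a finite function. -/
def fenchelConj {m : ℕ} (ω : Euc m → ℝ) (v : Euc m) : EReal :=
  ⨆ u : Euc m, ((inner ℝ u v - ω u : ℝ) : EReal)

/-- The effective domain of an extended-real-valued function. -/
def effDom {m : ℕ} (φ : Euc m → EReal) : Set (Euc m) := {v | φ v < ⊤}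

/-- The set of global minimizers. -/
def argminSet {m : ℕ} (φ : Euc m → EReal) : Set (Euc m) := {v | ∀ w, φ v ≤ φ w}

/-- `z = prox_{t φ}(w)`: `z` minimizes `u ↦ φ u + ‖w - u‖² / (2 t)`. -/
def IsProx {m : ℕ} (φ : Euc m → EReal) (t : ℝ) (w z : Euc m) : Prop :=
  z ∈ argminSet fun u => φ u + ((1 / (2 * t) * ‖w - u‖ ^ 2 : ℝ) : EReal)

/-- Quadratic growth with constant `κ`: minimizers exist, and
`φ v ≥ min φ + (κ / 2) dist(v, argmin φ)²` for all `v`. -/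
structure HasQuadraticGrowth {m : ℕ} (φ : Euc m → EReal) (κ : ℝ) : Prop where
  pos : 0 < κ
  nonempty : (argminSet φ).Nonempty
  growth : ∀ vbar ∈ argminSet φ, ∀ v,
    φ vbar + ((κ / 2 * Metric.infDist v (argminSet φ) ^ 2 : ℝ) : EReal) ≤ φ v

/-- The primal proximal objective `Φ(u) = ω(A u) + ‖u - y‖² / (2 lam)`. -/
def primalObj {n m : ℕ} (ω : Euc m → ℝ) (A : Euc n →L[ℝ] Euc m) (lam : ℝ) (y : Euc n)
    (u : Euc n) : ℝ :=
  ω (A u) + 1 / (2 * lam) * ‖u - y‖ ^ 2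

/-- `h(x) = ‖lam x - y‖² / (2 lam) - ‖y‖² / (2 lam)`. -/
def dualQuad {n : ℕ} (lam : ℝ) (y x : Euc n) : ℝ :=
  1 / (2 * lam) * ‖lam • x - y‖ ^ 2 - 1 / (2 * lam) * ‖y‖ ^ 2

/-- The dual proximal objective `Ψ(v) = h(Aᵀ v) + ω⋆(v)`. -/
def dualObj {n m : ℕ} (ω : Euc m → ℝ) (A : Euc n →L[ℝ] Euc m) (lam : ℝ) (y : Euc n)
    (v : Euc m) : EReal :=
  ((dualQuad lam y (A.adjoint v) : ℝ) : EReal) + fenchelConj ω v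

/-- The duality gap `G(u, v) = Φ(u) + Ψ(v)`. -/
def dualityGap {n m : ℕ} (ω : Euc m → ℝ) (A : Euc n →L[ℝ] Euc m) (lam : ℝ) (y : Euc n)
    (u : Euc n) (v : Euc m) : EReal :=
  ((primalObj ω A lam y u : ℝ) : EReal) + dualObj ω A lam y v

/-- Proximal gradient descent with line search on the dual proximal problem: `τ j` are the
line-search constants, `v j` the dual iterates and `z j` the associated primal iterates. -/
structure IsInnerLoop {n m : ℕ} (ω : Euc m → ℝ) (A : Euc n →L[ℝ] Euc m) (lam : ℝ) (y : Euc n)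
    (τ : ℕ → ℝ) (v : ℕ → Euc m) (z : ℕ → Euc n) : Prop where
  tau_pos : ∀ j, 0 < τ j
  init_mem : v 0 ∈ effDom (fenchelConj ω)
  step : ∀ j, IsProx (fenchelConj ω) (τ j)⁻¹
    (v j - (τ j)⁻¹ • A (gradient (dualQuad lam y) (A.adjoint (v j)))) (v (j + 1))
  lineSearch : ∀ j,
    bregman (fun w => dualQuad lam y (A.adjoint w)) (v (j + 1)) (v j)
      ≤ τ j / 2 * ‖v (j + 1) - v j‖ ^ 2
  primal : ∀ j, z j = y - lam • A.adjoint (v j)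

/-- The sequence `k ↦ a (k - 1)`, where `a (-1)` is the given initial value. -/
def prevSeq {X : Type} (init : X) (a : ℕ → X) : ℕ → X
  | 0 => init
  | k + 1 => a k

/-- The outer loop of the inexact accelerated proximal gradient method for `f + g`, started from
`xinit = x_{-1}` and `xoinit = x°_{-1}`, with step constants `L_k = B k + ρ k`. -/
structure IsIAPG {n : ℕ} (f g : Euc n → ℝ) (α B ρ ε : ℕ → ℝ) (xinit xoinit : Euc n)
    (x y xo : ℕ → Euc n) : Prop where
  alpha_pos : ∀ k, 0 < α k
  alpha_le_one : ∀ k, α k ≤ 1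
  B_pos : ∀ k, 0 < B k
  rho_nonneg : ∀ k, 0 ≤ ρ k
  eps_pos : ∀ k, 0 < ε k
  y_eq : ∀ k, y k = α k • prevSeq xoinit xo k + (1 - α k) • prevSeq xinit x k
  x_inexact : ∀ k, IsInexactProxGrad f g (ε k) (B k + ρ k) (y k) (x k)
  lineSearch : ∀ k, bregman f (x k) (y k) ≤ B k / 2 * ‖x k - y k‖ ^ 2
  xo_eq : ∀ k, xo k = prevSeq xinit x k + (α k)⁻¹ • (x k - prevSeq xinit x k)

/-- `β_k = ∏_{i=1}^k max(1 - α_i, α_i² L_i / (α_{i-1}² L_{i-1}))`. -/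
def betaSeq (α Ls : ℕ → ℝ) (k : ℕ) : ℝ :=
  ∏ i ∈ Finset.range k,
    max (1 - α (i + 1)) (α (i + 1) ^ 2 * Ls (i + 1) / (α i ^ 2 * Ls i))

/-- The optimal momentum and error schedule. Here `d k` stands for `‖x_k - y_k‖`. -/
structure IsOptimalSchedule (α Ls ρ ε d : ℕ → ℝ) (E₀ p Lmin Lmax : ℝ) : Prop where
  E_pos : 0 < E₀
  one_lt_p : 1 < p
  alpha_zero : α 0 = 1
  alpha_succ : ∀ k, 1 - α (k + 1) = α (k + 1) ^ 2 * Ls (k + 1) / (α k ^ 2 * Ls k)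
  Lmin_pos : 0 < Lmin
  Lmin_le : ∀ k, Lmin ≤ Ls k
  le_Lmax : ∀ k, Ls k ≤ Lmax
  eps_zero : ε 0 = E₀
  eps_eq : ∀ k : ℕ, 1 ≤ k → ε k = E₀ * betaSeq α Ls k / (k : ℝ) ^ p + ρ k / 2 * d k ^ 2

/-- `R_∞(p) = E₀ (1 + ∑_{l ≥ 1} l^{-p})`. -/
def errorSum (E₀ p : ℝ) : ℝ := E₀ * (1 + ∑' l : ℕ, 1 / ((l : ℝ) + 1) ^ p)

end

/-! The cost is (number of outer steps) × (largest number of inner steps), the first factor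
polynomial in the accuracy and the second logarithmic.

Outer loop. The momentum rule gives `α k ^ 2 * Ls k = β_k * Ls 0` and `1 - α (k+1) = β_(k+1) / β_k`.
Hence the energy `F (x k) - F xbar + β_k * (Ls 0 / 2) * ‖xbar - xo k‖ ^ 2`, divided by `β_k`, grows
at each step only by `E₀ k^(-p)`, because the `ρ` part of the tolerance cancels; these errors are
summable (`IsIAPG.lyapunov`). So the value gap is at most `C₂ β_k` and `xo k` stays within `C₃` of
`xbar`. As `β_k^(-1/2)` lies between two linear functions of `k`
(`IsOptimalSchedule.inv_sqrt_betaSeq`), the value gap is `O(k^(-2))`, the residual `x k - y k = α k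
(xo k - xo (k-1))` is `O(1/k)`, and `ε k` is at least a constant times `k^(-(2+p))`.

Inner loop. A dual prox step combined with quadratic growth shrinks the squared distance to the dual
solutions by the factor `C₄`. Strong duality and Lipschitz continuity bound the gap by the square
root of the dual suboptimality plus that suboptimality, so the gap decays like `√C₄^(-j)`
(`IsInnerLoop.dualityGap_le`). Reaching a tolerance of order `k^(-(2+p))` therefore takes `O(log k)`
inner steps. -/

/-! ### Gradients of convex smooth functions -/

/-- First-order characterization of convexity for a differentiable function. -/
lemma ConvexOn.add_inner_gradient_le {n : ℕ} {f : Euc n → ℝ} (hf : ConvexOn ℝ Set.univ f)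
    {y : Euc n} (hd : DifferentiableAt ℝ f y) (z : Euc n) :
    f y + inner ℝ (gradient f y) (z - y) ≤ f z := by
  have hl : HasDerivAt (fun t : ℝ => AffineMap.lineMap (k := ℝ) y z t) (z - y) 0 :=
    AffineMap.hasDerivAt_lineMap
  have hd' : HasFDerivAt f (fderiv ℝ f y) (AffineMap.lineMap (k := ℝ) y z (0 : ℝ)) := by
    simpa using hd.hasFDerivAt
  have h1 : HasDerivAt (f ∘ (AffineMap.lineMap (k := ℝ) y z)) (fderiv ℝ f y (z - y)) 0 :=
    hd'.comp_hasDerivAt (0 : ℝ) hl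
  have h2 : ConvexOn ℝ Set.univ (f ∘ (AffineMap.lineMap (k := ℝ) y z)) := by
    simpa using hf.comp_affineMap (AffineMap.lineMap (k := ℝ) y z)
  have h3 := h2.le_slope_of_hasDerivAt (Set.mem_univ 0) (Set.mem_univ 1) zero_lt_one h1
  rw [inner_gradient_left]
  simp [slope_def_field] at h3 ⊢
  linarith

/-- The gradient of a convex `L`-smooth function is `L`-Lipschitz. -/
lemma IsLipschitzSmooth.norm_gradient_sub_le {n : ℕ} {f : Euc n → ℝ} {L : ℝ}
    (hf : IsLipschitzSmooth f L) (x y : Euc n) :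
    ‖gradient f x - gradient f y‖ ≤ L * ‖x - y‖ := by
  -- Compare two bounds at `z`, a gradient-difference step from `x`: descent from `x` above, the
  -- tangent at `y` below.
  have key : ∀ (x y : Euc n) (t : ℝ), t * ‖gradient f x - gradient f y‖ ^ 2
      - L / 2 * t ^ 2 * ‖gradient f x - gradient f y‖ ^ 2 ≤ bregman f x y := by
    intro x y t
    set z := x + t • (gradient f y - gradient f x) with hz
    have h1 := hf.descent z x
    have h2 := hf.convex.add_inner_gradient_le (hf.differentiable y) z
    have hzx : z - x = t • (gradient f y - gradient f x) := by simp [hz]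
    have hzy : z - y = (x - y) + t • (gradient f y - gradient f x) := by rw [hz]; abel
    have hn : ‖z - x‖ ^ 2 = t ^ 2 * ‖gradient f x - gradient f y‖ ^ 2 := by
      rw [hzx, norm_smul, norm_sub_rev, mul_pow, Real.norm_eq_abs, sq_abs]
    have hi : inner ℝ (gradient f y) (gradient f y - gradient f x)
        - inner ℝ (gradient f x) (gradient f y - gradient f x)
        = ‖gradient f x - gradient f y‖ ^ 2 := by
      rw [← inner_sub_left, real_inner_self_eq_norm_sq, norm_sub_rev]
    rw [hn] at h1
    unfold bregman at h1 ⊢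
    rw [hzx, inner_smul_right] at h1
    rw [hzy, inner_add_right, inner_smul_right] at h2
    linear_combination h1 + h2 - t * hi
  set G := ‖gradient f x - gradient f y‖ with hG
  -- Since `L` may be `0`, the step is `t = M⁻¹` with `M > L`, and then `M` decreases to `L`.
  have hmono : ∀ M, L < M → G ≤ M * ‖x - y‖ := by
    intro M hM
    have hM0 : 0 < M := hf.nonneg.trans_lt hM
    have h1 := key x y M⁻¹
    have h2 := key y x M⁻¹
    rw [norm_sub_rev (gradient f y)] at h2
    have h3 : bregman f x y + bregman f y x ≤ G * ‖x - y‖ := by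
      have := real_inner_le_norm (gradient f x - gradient f y) (x - y)
      rw [inner_sub_left] at this
      unfold bregman
      rw [← neg_sub x y, inner_neg_right, hG]
      linarith
    rw [← hG] at h1 h2
    have h4 : M⁻¹ * G ^ 2 ≤ G * ‖x - y‖ := by
      have : L * M⁻¹ ^ 2 * G ^ 2 ≤ M⁻¹ * G ^ 2 := by
        gcongr
        rw [pow_two, ← mul_assoc]
        calc L * M⁻¹ * M⁻¹ ≤ M * M⁻¹ * M⁻¹ := by gcongr
          _ = M⁻¹ := by field_simp
      linarith
    rcases (norm_nonneg (gradient f x - gradient f y)).eq_or_lt with h0 | h0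
    · rw [hG, ← h0]; positivity
    · rw [← hG] at h0
      have h5 : M⁻¹ * G ≤ ‖x - y‖ := by
        refine le_of_mul_le_mul_left ?_ h0
        linarith
      rwa [inv_mul_le_iff₀ hM0] at h5
  have hlim : Tendsto (fun M : ℝ => M * ‖x - y‖) (𝓝[>] L) (𝓝 (L * ‖x - y‖)) :=
    ((continuous_id.mul continuous_const).tendsto L).mono_left nhdsWithin_le_nhds
  exact ge_of_tendsto hlim (eventually_nhdsWithin_of_forall hmono)

/-! ### Fenchel conjugate of a finite function -/

/-- The Fenchel conjugate as a real-valued function, meaningful on the effective domain. -/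
noncomputable def conjReal {m : ℕ} (ω : Euc m → ℝ) (v : Euc m) : ℝ := (fenchelConj ω v).toReal

section Conjugate

variable {m : ℕ} {ω : Euc m → ℝ}

lemma coe_le_fenchelConj (u v : Euc m) :
    ((inner ℝ u v - ω u : ℝ) : EReal) ≤ fenchelConj ω v :=
  le_iSup (fun u : Euc m => ((inner ℝ u v - ω u : ℝ) : EReal)) u

lemma fenchelConj_ne_bot (v : Euc m) : fenchelConj ω v ≠ ⊥ :=
  ((EReal.bot_lt_coe _).trans_le (coe_le_fenchelConj 0 v)).ne'

lemma coe_conjReal {v : Euc m} (hv : v ∈ effDom (fenchelConj ω)) :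
    ((conjReal ω v : ℝ) : EReal) = fenchelConj ω v :=
  EReal.coe_toReal (ne_of_lt hv) (fenchelConj_ne_bot v)

lemma inner_sub_le_conjReal {v : Euc m} (hv : v ∈ effDom (fenchelConj ω)) (u : Euc m) :
    inner ℝ u v - ω u ≤ conjReal ω v := by
  rw [← EReal.coe_le_coe_iff, coe_conjReal hv]
  exact coe_le_fenchelConj u v

lemma mem_effDom_of_forall_le {v : Euc m} {c : ℝ} (h : ∀ u, inner ℝ u v - ω u ≤ c) :
    v ∈ effDom (fenchelConj ω) ∧ conjReal ω v ≤ c := by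
  have h1 : fenchelConj ω v ≤ (c : EReal) := iSup_le fun u => EReal.coe_le_coe (h u)
  have h2 : v ∈ effDom (fenchelConj ω) := h1.trans_lt (EReal.coe_lt_top c)
  refine ⟨h2, ?_⟩
  rwa [← EReal.coe_le_coe_iff, coe_conjReal h2]

lemma conjReal_convex {u v : Euc m} (hu : u ∈ effDom (fenchelConj ω))
    (hv : v ∈ effDom (fenchelConj ω)) {t : ℝ} (h0 : 0 ≤ t) (h1 : t ≤ 1) :
    v + t • (u - v) ∈ effDom (fenchelConj ω) ∧
      conjReal ω (v + t • (u - v)) ≤ (1 - t) * conjReal ω v + t * conjReal ω u := by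
  refine mem_effDom_of_forall_le fun w => ?_
  have hu' := mul_le_mul_of_nonneg_left (inner_sub_le_conjReal hu w) h0
  have hv' := mul_le_mul_of_nonneg_left (inner_sub_le_conjReal hv w) (sub_nonneg.2 h1)
  rw [inner_add_right, inner_smul_right, inner_sub_right]
  linarith

/-- The effective domain of the conjugate of a `K`-Lipschitz function lies in the `K`-ball. -/
lemma norm_le_of_mem_effDom {K : NNReal} (hω : LipschitzWith K ω) {v : Euc m}
    (hv : v ∈ effDom (fenchelConj ω)) : ‖v‖ ≤ K := by
  by_contra! h
  have hv0 : 0 < ‖v‖ := K.2.trans_lt h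
  set c := conjReal ω v + ω 0 with hc
  -- Testing the supremum along `t • v` gives linear growth in `t` as soon as `‖v‖ > K`,
  -- contradicting finiteness.
  have key : ∀ t : ℝ, 0 < t → t * (‖v‖ * (‖v‖ - K)) ≤ c := by
    intro t ht
    have h1 := inner_sub_le_conjReal hv (t • v)
    have h2 := hω.dist_le_mul (t • v) 0
    rw [dist_zero_right, norm_smul, Real.norm_of_nonneg ht.le, Real.dist_eq] at h2
    have h3 := le_abs_self (ω (t • v) - ω 0)
    rw [real_inner_smul_left, real_inner_self_eq_norm_sq] at h1
    nlinarith
  have hp : 0 < ‖v‖ * (‖v‖ - K) := mul_pos hv0 (sub_pos.2 h)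
  have h1 := key ((|c| + 1) / (‖v‖ * (‖v‖ - K))) (by positivity)
  rw [div_mul_cancel₀ _ hp.ne'] at h1
  linarith [le_abs_self c]

lemma isBounded_effDom {K : NNReal} (hω : LipschitzWith K ω) :
    Bornology.IsBounded (effDom (fenchelConj ω)) :=
  isBounded_iff_forall_norm_le.2 ⟨K, fun _ hv => norm_le_of_mem_effDom hω hv⟩

/-- Minimizers of `ω⋆ + q` over the whole space, restated with real values. -/
lemma argmin_conj_add {q : Euc m → ℝ} {v v₀ : Euc m}
    (h₀ : v₀ ∈ effDom (fenchelConj ω))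
    (hv : v ∈ argminSet fun u => fenchelConj ω u + (q u : EReal)) :
    v ∈ effDom (fenchelConj ω) ∧
      ∀ u ∈ effDom (fenchelConj ω), conjReal ω v + q v ≤ conjReal ω u + q u := by
  have hd : v ∈ effDom (fenchelConj ω) := by
    have h1 : fenchelConj ω v + (q v : EReal) ≤ fenchelConj ω v₀ + (q v₀ : EReal) := hv v₀
    rw [← coe_conjReal h₀, ← EReal.coe_add] at h1
    by_contra h
    have htop : fenchelConj ω v = ⊤ := not_lt_top_iff.1 h
    rw [htop, EReal.top_add_coe] at h1
    exact absurd (h1.trans_lt (EReal.coe_lt_top _)) (lt_irrefl _)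
  refine ⟨hd, fun u hu => ?_⟩
  have h1 : fenchelConj ω v + (q v : EReal) ≤ fenchelConj ω u + (q u : EReal) := hv u
  rw [← coe_conjReal hd, ← coe_conjReal hu] at h1
  exact_mod_cast h1

/-- First-order optimality condition for `ω⋆ + q` with `q` quadratic along segments. -/
lemma conjReal_le_of_isMin {q : Euc m → ℝ} {v u g : Euc m}
    (hd : v ∈ effDom (fenchelConj ω)) (hu : u ∈ effDom (fenchelConj ω))
    (hmin : ∀ w ∈ effDom (fenchelConj ω), conjReal ω v + q v ≤ conjReal ω w + q w)
    {c : ℝ} (hq : ∀ t : ℝ, q (v + t • (u - v)) ≤ q v + t * inner ℝ g (u - v) + t ^ 2 * c) :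
    conjReal ω v ≤ conjReal ω u + inner ℝ g (u - v) := by
  -- Minimality is tested at `v + t • (u - v)`; convexity of the conjugate allows division by `t`,
  -- and `t → 0` removes the quadratic term.
  have key : ∀ t : ℝ, t ∈ Set.Ioc (0 : ℝ) 1 →
      conjReal ω v ≤ conjReal ω u + inner ℝ g (u - v) + t * c := by
    intro t ht
    obtain ⟨h1, h2⟩ := conjReal_convex hu hd ht.1.le ht.2
    have h3 := hmin _ h1
    have h4 := hq t
    have h5 : t * conjReal ω v ≤ t * (conjReal ω u + inner ℝ g (u - v) + t * c) := by linarith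
    exact le_of_mul_le_mul_left h5 ht.1
  have hlim : Tendsto (fun t : ℝ => conjReal ω u + inner ℝ g (u - v) + t * c) (𝓝[>] 0)
      (𝓝 (conjReal ω u + inner ℝ g (u - v) + 0 * c)) :=
    ((continuous_const.add (continuous_id.mul continuous_const)).tendsto 0).mono_left
      nhdsWithin_le_nhds
  have := ge_of_tendsto hlim (eventually_of_mem (Ioc_mem_nhdsGT zero_lt_one) key)
  simpa using this

/-- Fenchel equality from a subgradient of the conjugate. -/
lemma add_conjReal_le_inner (hω : ConvexOn ℝ Set.univ ω) (hc : Continuous ω) {v w : Euc m}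
    (h : ∀ u ∈ effDom (fenchelConj ω), conjReal ω v ≤ conjReal ω u + inner ℝ w (v - u)) :
    ω w + conjReal ω v ≤ inner ℝ w v := by
  -- An affine minorant of `ω` taking the value `a < ω w` at `w` has its slope `s` in the effective
  -- domain, with conjugate at most `-c`; test `h` at `s`. Staying below `ω w` avoids producing a
  -- subgradient at `w`.
  have key : ∀ a, a < ω w → a + conjReal ω v ≤ inner ℝ w v := by
    intro a ha
    obtain ⟨l, c, hle, heq⟩ := hω.exists_affine_le_of_lt (𝕜 := ℝ) (Set.mem_univ w) ha isClosed_univ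
      (hc.lowerSemicontinuous.lowerSemicontinuousOn _)
    set s := (InnerProductSpace.toDual ℝ (Euc m)).symm l with hs
    have hl : ∀ u, inner ℝ s u = l u := fun u => InnerProductSpace.toDual_symm_apply
    have h1 : ∀ u, l u + c ≤ ω u := fun u => by simpa using hle ⟨u, Set.mem_univ u⟩
    have heq' : l w + c = a := by simpa using heq
    obtain ⟨h2, h3⟩ := mem_effDom_of_forall_le (ω := ω) (v := s) (c := -c) (fun u => by
      rw [real_inner_comm, hl]; linarith [h1 u])
    have h4 := h s h2
    have h5 := hl w
    rw [real_inner_comm] at h5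
    rw [inner_sub_right, h5] at h4
    linarith
  by_contra! hlt
  have := key ((ω w + (inner ℝ w v - conjReal ω v)) / 2) (by linarith)
  linarith

end Conjugate

/-! ### The quadratic part of the dual objective -/

lemma hasGradientAt_of_quadratic {m : ℕ} {g : Euc m → ℝ} {w a : Euc m} {r : Euc m → ℝ} {C : ℝ}
    (h : ∀ d, g (w + d) = g w + inner ℝ a d + r d) (hr : ∀ d, |r d| ≤ C * ‖d‖ ^ 2) :
    HasGradientAt g a w := by
  rw [hasGradientAt_iff_isLittleO_nhds_zero]
  have h1 : (fun d => g (w + d) - g w - inner ℝ a d) = r := by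
    funext d; rw [h]; ring
  rw [h1]
  refine (IsBigO.of_bound C (Eventually.of_forall fun d => ?_) : r =O[𝓝 0] fun d => ‖d‖ ^ 2).trans_isLittleO
    ((isLittleO_norm_pow_id one_lt_two))
  simpa using hr d

section DualQuad

variable {n m : ℕ} {lam : ℝ}

lemma dualQuad_eq (hlam : lam ≠ 0) (y x : Euc n) :
    dualQuad lam y x = lam / 2 * ‖x‖ ^ 2 - inner ℝ x y := by
  unfold dualQuad
  rw [norm_sub_sq_real, norm_smul, real_inner_smul_left, mul_pow, Real.norm_eq_abs, sq_abs]
  field_simp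
  ring

lemma dualQuad_add (hlam : lam ≠ 0) (y x d : Euc n) :
    dualQuad lam y (x + d) = dualQuad lam y x + inner ℝ (lam • x - y) d + lam / 2 * ‖d‖ ^ 2 := by
  rw [dualQuad_eq hlam, dualQuad_eq hlam, norm_add_sq_real, inner_add_left, inner_sub_left,
    real_inner_smul_left, real_inner_comm d y]
  ring

lemma gradient_dualQuad (hlam : lam ≠ 0) (y x : Euc n) :
    gradient (dualQuad lam y) x = lam • x - y := by
  refine (hasGradientAt_of_quadratic (r := fun d => lam / 2 * ‖d‖ ^ 2) (C := |lam / 2|)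
    (dualQuad_add hlam y x) fun d => ?_).gradient
  rw [abs_mul, abs_of_nonneg (sq_nonneg ‖d‖)]

/-- The expansion has no error term, so the Bregman divergence of `h ∘ Aᵀ` is exactly its quadratic
part. -/
lemma dualQuad_adjoint_add (hlam : lam ≠ 0) (A : Euc n →L[ℝ] Euc m) (y : Euc n) (w d : Euc m) :
    dualQuad lam y (A.adjoint (w + d)) = dualQuad lam y (A.adjoint w)
      + inner ℝ (A (lam • A.adjoint w - y)) d + lam / 2 * ‖A.adjoint d‖ ^ 2 := by
  rw [map_add, dualQuad_add hlam, ContinuousLinearMap.adjoint_inner_right]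

lemma bregman_dualQuad_adjoint (hlam : lam ≠ 0) (A : Euc n →L[ℝ] Euc m) (y : Euc n)
    (w' w : Euc m) :
    bregman (fun w => dualQuad lam y (A.adjoint w)) w' w
      = lam / 2 * ‖A.adjoint (w' - w)‖ ^ 2 := by
  have hg : gradient (fun w => dualQuad lam y (A.adjoint w)) w = A (lam • A.adjoint w - y) := by
    refine (hasGradientAt_of_quadratic (r := fun d => lam / 2 * ‖A.adjoint d‖ ^ 2)
      (C := |lam / 2| * ‖A.adjoint‖ ^ 2) (dualQuad_adjoint_add hlam A y w) fun d => ?_).gradient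
    rw [abs_mul, abs_of_nonneg (sq_nonneg ‖A.adjoint d‖), mul_assoc, ← mul_pow]
    gcongr
    exact A.adjoint.le_opNorm d
  have h := dualQuad_adjoint_add hlam A y w (w' - w)
  rw [add_sub_cancel] at h
  unfold bregman
  rw [hg]
  simp only [h]
  ring

end DualQuad

/-! ### Linear convergence of the inner loop -/

section InnerLoop

variable {n m : ℕ} {ω : Euc m → ℝ} {A : Euc n →L[ℝ] Euc m} {lam : ℝ} {y : Euc n}

/-- One dual proximal gradient step with line search. -/
lemma proxGrad_step (hlam : 0 < lam) {t : ℝ} (ht : 0 < t) {v v' : Euc m}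
    (hv : v ∈ effDom (fenchelConj ω))
    (hstep : IsProx (fenchelConj ω) t⁻¹
      (v - t⁻¹ • A (gradient (dualQuad lam y) (A.adjoint v))) v')
    (hls : bregman (fun w => dualQuad lam y (A.adjoint w)) v' v ≤ t / 2 * ‖v' - v‖ ^ 2) :
    v' ∈ effDom (fenchelConj ω) ∧ ∀ u ∈ effDom (fenchelConj ω),
      conjReal ω v' + dualQuad lam y (A.adjoint v') + t / 2 * ‖u - v'‖ ^ 2
        ≤ conjReal ω u + dualQuad lam y (A.adjoint u) + t / 2 * ‖u - v‖ ^ 2 := by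
  rw [gradient_dualQuad hlam.ne'] at hstep
  set G := A (lam • A.adjoint v - y) with hG
  obtain ⟨hd, hmin⟩ := argmin_conj_add hv hstep
  refine ⟨hd, fun u hu => ?_⟩
  -- The vector `g` is the gradient of the prox quadratic at `v'`, and `c` is its second-order
  -- coefficient along the segment to `u`.
  have h1 := conjReal_le_of_isMin (q := fun u => 1 / (2 * t⁻¹) * ‖v - t⁻¹ • G - u‖ ^ 2) (g := t • (v' - v) + G) (c := t / 2 * ‖u - v'‖ ^ 2)
    hd hu hmin (fun s => le_of_eq ?_)
  · have h2 := dualQuad_adjoint_add hlam.ne' A y v (v' - v)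
    have h3 := dualQuad_adjoint_add hlam.ne' A y v (u - v)
    rw [add_sub_cancel, ← hG] at h2 h3
    rw [bregman_dualQuad_adjoint hlam.ne'] at hls
    -- Convexity of `h ∘ Aᵀ`: this remainder at `u` is discarded, while the one at `v'` is absorbed
    -- by the line search.
    have h4 : 0 ≤ lam / 2 * ‖A.adjoint (u - v)‖ ^ 2 := by positivity
    have h5 : ‖u - v‖ ^ 2 = ‖u - v'‖ ^ 2 + 2 * inner ℝ (u - v') (v' - v) + ‖v' - v‖ ^ 2 := by
      rw [← norm_add_sq_real]; congr 2; abel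
    have h6 : inner ℝ G (u - v) = inner ℝ G (u - v') + inner ℝ G (v' - v) := by
      rw [← inner_add_right]; congr 1; abel
    rw [inner_add_left, real_inner_smul_left, real_inner_comm] at h1
    linear_combination h1 + h2 - h3 + hls + h4 - t / 2 * h5 - h6
  · have e : v - t⁻¹ • G - (v' + s • (u - v')) = (v - t⁻¹ • G - v') - s • (u - v') := by abel
    have e2 : t • (v' - v) + G = - (t • (v - t⁻¹ • G - v')) := by
      rw [smul_sub, smul_sub t (v - _), smul_sub, smul_smul, mul_inv_cancel₀ ht.ne', one_smul]; abel
    rw [e, e2, norm_sub_sq_real, inner_neg_left, real_inner_smul_left, inner_smul_right, norm_smul,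
      mul_pow, Real.norm_eq_abs, sq_abs]
    field_simp
    ring

/-- The primal-dual objective along the dual variable: `Φ(y - lam Aᵀ v) + Ψ(v)`. -/
lemma dualityGap_eq {v : Euc m} (hv : v ∈ effDom (fenchelConj ω)) :
    dualityGap ω A lam y (y - lam • A.adjoint v) v
      = ((ω (A (y - lam • A.adjoint v)) + lam / 2 * ‖A.adjoint v‖ ^ 2
          + (conjReal ω v + dualQuad lam y (A.adjoint v)) : ℝ) : EReal) := by
  have h : primalObj ω A lam y (y - lam • A.adjoint v)
      = ω (A (y - lam • A.adjoint v)) + lam / 2 * ‖A.adjoint v‖ ^ 2 := by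
    unfold primalObj
    rw [sub_sub_cancel_left, norm_neg, norm_smul, mul_pow, Real.norm_eq_abs, sq_abs]
    field_simp
  unfold dualityGap dualObj
  rw [h, ← coe_conjReal hv, ← EReal.coe_add, ← EReal.coe_add, add_comm (conjReal ω v)]

lemma IsInnerLoop.mem_effDom {τ : ℕ → ℝ} {v : ℕ → Euc m} {z : ℕ → Euc n}
    (h : IsInnerLoop ω A lam y τ v z) (hlam : 0 < lam) :
    ∀ j, v j ∈ effDom (fenchelConj ω)
  | 0 => h.init_mem
  | j + 1 => (proxGrad_step hlam (h.tau_pos j) (h.mem_effDom hlam j) (h.step j) (h.lineSearch j)).1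

/-- Minimizers of the dual objective, restated with real values. -/
lemma argmin_dualObj {vb v₀ : Euc m} (h₀ : v₀ ∈ effDom (fenchelConj ω))
    (hvb : vb ∈ argminSet (dualObj ω A lam y)) :
    vb ∈ effDom (fenchelConj ω) ∧ ∀ u ∈ effDom (fenchelConj ω),
      conjReal ω vb + dualQuad lam y (A.adjoint vb)
        ≤ conjReal ω u + dualQuad lam y (A.adjoint u) := by
  refine argmin_conj_add (q := fun u => dualQuad lam y (A.adjoint u)) h₀ fun u => ?_
  have := hvb u
  unfold dualObj at this
  simpa only [add_comm] using this

/-- First-order optimality condition at a minimizer of the dual objective. -/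
lemma conjReal_le_of_argmin_dualObj (hlam : 0 < lam) {vb v₀ : Euc m}
    (h₀ : v₀ ∈ effDom (fenchelConj ω)) (hvb : vb ∈ argminSet (dualObj ω A lam y))
    {u : Euc m} (hu : u ∈ effDom (fenchelConj ω)) :
    conjReal ω vb ≤ conjReal ω u + inner ℝ (A (lam • A.adjoint vb - y)) (u - vb) := by
  obtain ⟨hd, hmin⟩ := argmin_dualObj h₀ hvb
  refine conjReal_le_of_isMin (q := fun u => dualQuad lam y (A.adjoint u)) hd hu hmin
    (c := lam / 2 * ‖A.adjoint (u - vb)‖ ^ 2) fun t => le_of_eq ?_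
  rw [dualQuad_adjoint_add hlam.ne', inner_smul_right, map_smul, norm_smul, mul_pow,
    Real.norm_eq_abs, sq_abs]
  ring

/-- Quadratic growth of the dual objective in terms of the primal iterates. -/
lemma dualObj_growth_adjoint (hlam : 0 < lam) {vb v₀ : Euc m}
    (h₀ : v₀ ∈ effDom (fenchelConj ω)) (hvb : vb ∈ argminSet (dualObj ω A lam y))
    {u : Euc m} (hu : u ∈ effDom (fenchelConj ω)) :
    lam / 2 * ‖A.adjoint (u - vb)‖ ^ 2
      ≤ conjReal ω u + dualQuad lam y (A.adjoint u)
        - (conjReal ω vb + dualQuad lam y (A.adjoint vb)) := by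
  have h1 := conjReal_le_of_argmin_dualObj hlam h₀ hvb hu
  have h2 := dualQuad_adjoint_add hlam.ne' A y vb (u - vb)
  rw [add_sub_cancel] at h2
  linarith

/-- Strong duality: the gap vanishes at a minimizer of the dual objective. -/
lemma gap_argmin_nonpos (hω : ConvexOn ℝ Set.univ ω) (hc : Continuous ω) (hlam : 0 < lam)
    {vb v₀ : Euc m} (h₀ : v₀ ∈ effDom (fenchelConj ω))
    (hvb : vb ∈ argminSet (dualObj ω A lam y)) :
    ω (A (y - lam • A.adjoint vb)) + lam / 2 * ‖A.adjoint vb‖ ^ 2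
      + (conjReal ω vb + dualQuad lam y (A.adjoint vb)) ≤ 0 := by
  -- Dual optimality says that `A (y - lam • A.adjoint vb)` is a subgradient of the conjugate at
  -- `vb`, so Fenchel's inequality is tight there; the quadratic terms then cancel.
  have h1 : ω (A (y - lam • A.adjoint vb)) + conjReal ω vb
      ≤ inner ℝ (A (y - lam • A.adjoint vb)) vb := by
    refine add_conjReal_le_inner hω hc fun u hu => ?_
    have := conjReal_le_of_argmin_dualObj hlam h₀ hvb hu
    rwa [← neg_sub y, ← neg_sub vb, map_neg, inner_neg_neg] at this
  rw [← ContinuousLinearMap.adjoint_inner_right, inner_sub_left, real_inner_smul_left,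
    real_inner_self_eq_norm_sq, real_inner_comm] at h1
  rw [dualQuad_eq hlam.ne']
  linarith

/-- The gap is controlled by the dual suboptimality. -/
lemma gap_le_of_subopt {K : NNReal} (hω : ConvexOn ℝ Set.univ ω) (hK : LipschitzWith K ω)
    (hlam : 0 < lam) {vb u : Euc m} (hu : u ∈ effDom (fenchelConj ω))
    (hvb : vb ∈ argminSet (dualObj ω A lam y)) {δ : ℝ}
    (hδ : conjReal ω u + dualQuad lam y (A.adjoint u)
        - (conjReal ω vb + dualQuad lam y (A.adjoint vb)) ≤ δ) :
    ω (A (y - lam • A.adjoint u)) + lam / 2 * ‖A.adjoint u‖ ^ 2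
      + (conjReal ω u + dualQuad lam y (A.adjoint u))
      ≤ 2 * ‖A‖ * K * √(2 * lam * δ) + δ := by
  have h0 := gap_argmin_nonpos hω hK.continuous hlam hu hvb
  have h1 := dualObj_growth_adjoint hlam hu hvb hu
  have hvd := (argmin_dualObj hu hvb).1
  set a := A.adjoint u with ha
  set b := A.adjoint vb with hb
  have hab : A.adjoint (u - vb) = a - b := by rw [map_sub]
  rw [hab] at h1
  have hn : ∀ w ∈ effDom (fenchelConj ω), ‖A.adjoint w‖ ≤ ‖A‖ * K := by
    intro w hw
    refine (A.adjoint.le_opNorm w).trans ?_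
    rw [LinearIsometryEquiv.norm_map]
    gcongr
    exact norm_le_of_mem_effDom hK hw
  have h2 : lam * ‖a - b‖ ≤ √(2 * lam * δ) := by
    refine Real.le_sqrt_of_sq_le ?_
    have := mul_le_mul_of_nonneg_left (h1.trans hδ) (by positivity : 0 ≤ 2 * lam)
    calc (lam * ‖a - b‖) ^ 2 = 2 * lam * (lam / 2 * ‖a - b‖ ^ 2) := by ring
      _ ≤ _ := this
  have h3 : ω (A (y - lam • a)) - ω (A (y - lam • b)) ≤ ‖A‖ * K * (lam * ‖a - b‖) := by
    have h4 := hK.dist_le_mul (A (y - lam • a)) (A (y - lam • b))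
    rw [Real.dist_eq, dist_eq_norm, ← map_sub] at h4
    have h5 : y - lam • a - (y - lam • b) = -(lam • (a - b)) := by rw [smul_sub]; abel
    have h6 := A.le_opNorm (y - lam • a - (y - lam • b))
    rw [h5, norm_neg, norm_smul, Real.norm_of_nonneg hlam.le] at h6
    rw [h5] at h4
    calc _ ≤ _ := le_abs_self _
      _ ≤ _ := h4
      _ ≤ K * (‖A‖ * (lam * ‖a - b‖)) := by gcongr
      _ = _ := by ring
  -- Factor the difference of squares: both norms are at most `‖A‖ * K`. This matches the Lipschitz
  -- bound on `ω ∘ A`, whence the factor `2` in the conclusion.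
  have h4 : lam / 2 * ‖a‖ ^ 2 - lam / 2 * ‖b‖ ^ 2 ≤ ‖A‖ * K * (lam * ‖a - b‖) := by
    have h5 : ‖a‖ - ‖b‖ ≤ ‖a - b‖ := norm_sub_norm_le a b
    have h6 : ‖a‖ + ‖b‖ ≤ 2 * (‖A‖ * K) := by linarith [hn u hu, hn vb hvd]
    have h7 : (‖a‖ - ‖b‖) * (‖a‖ + ‖b‖) ≤ ‖a - b‖ * (2 * (‖A‖ * K)) := by
      calc _ ≤ ‖a - b‖ * (‖a‖ + ‖b‖) := by gcongr
        _ ≤ _ := by gcongr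
    calc _ = lam / 2 * ((‖a‖ - ‖b‖) * (‖a‖ + ‖b‖)) := by ring
      _ ≤ lam / 2 * (‖a - b‖ * (2 * (‖A‖ * K))) := by gcongr
      _ = _ := by ring
  have h5 : ‖A‖ * K * (lam * ‖a - b‖) ≤ ‖A‖ * K * √(2 * lam * δ) := by gcongr
  linarith

/-- Linear convergence of the distance to the dual solutions and of the dual objective. -/
lemma IsInnerLoop.dist_subopt_le {K : NNReal} (hK : LipschitzWith K ω) (hlam : 0 < lam)
    {τ : ℕ → ℝ} {v : ℕ → Euc m} {z : ℕ → Euc n} (h : IsInnerLoop ω A lam y τ v z)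
    {κ : ℝ} (hκ : HasQuadraticGrowth (dualObj ω A lam y) κ) {c : ℝ} (hc : 0 < c)
    (hcτ : ∀ j, τ j * c ≤ τ j + κ) {vb : Euc m} (hvb : vb ∈ argminSet (dualObj ω A lam y)) (j : ℕ) :
    Metric.infDist (v j) (argminSet (dualObj ω A lam y)) ^ 2
        ≤ Metric.diam (effDom (fenchelConj ω)) ^ 2 / c ^ j ∧
    conjReal ω (v (j + 1)) + dualQuad lam y (A.adjoint (v (j + 1)))
        - (conjReal ω vb + dualQuad lam y (A.adjoint vb))
      ≤ τ j / 2 * (Metric.diam (effDom (fenchelConj ω)) ^ 2 / c ^ j) := by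
  set S := argminSet (dualObj ω A lam y) with hS
  have hd := h.mem_effDom hlam
  have hτ := h.tau_pos
  set D := fun j => Metric.infDist (v j) S with hD
  have hD0 : ∀ j, 0 ≤ D j := fun j => Metric.infDist_nonneg
  set δ := fun j => conjReal ω (v j) + dualQuad lam y (A.adjoint (v j))
        - (conjReal ω vb + dualQuad lam y (A.adjoint vb)) with hδ
  have hgrow : ∀ j, κ / 2 * D j ^ 2 ≤ δ j := by
    intro j
    have h1 := hκ.growth vb hvb (v j)
    unfold dualObj at h1
    rw [← coe_conjReal (hd j), ← coe_conjReal (argmin_dualObj (hd 0) hvb).1] at h1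
    have h2 : dualQuad lam y (A.adjoint vb) + conjReal ω vb + κ / 2 * D j ^ 2
        ≤ dualQuad lam y (A.adjoint (v j)) + conjReal ω (v j) := by exact_mod_cast h1
    simp only [hδ]
    linarith
  have hstep : ∀ j, δ (j + 1) + τ j / 2 * D (j + 1) ^ 2 ≤ τ j / 2 * D j ^ 2 := by
    intro j
    have key : ∀ w ∈ S, δ (j + 1) + τ j / 2 * D (j + 1) ^ 2 ≤ τ j / 2 * dist (v j) w ^ 2 := by
      intro w hw
      obtain ⟨hwd, hwmin⟩ := argmin_dualObj (hd 0) hw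
      have h1 := (proxGrad_step hlam (hτ j) (hd j) (h.step j) (h.lineSearch j)).2 w hwd
      have h2 : D (j + 1) ≤ ‖w - v (j + 1)‖ := by
        rw [← dist_eq_norm, dist_comm]; exact Metric.infDist_le_dist_of_mem hw
      have h3 : τ j / 2 * D (j + 1) ^ 2 ≤ τ j / 2 * ‖w - v (j + 1)‖ ^ 2 := by
        have := hτ j
        have := hD0 (j + 1)
        gcongr
      have h4 := hwmin vb (argmin_dualObj (hd 0) hvb).1
      rw [dist_comm, dist_eq_norm]
      simp only [hδ]
      linarith
    -- The distance is approached by minimizers at distance less than `r > D j`, so attainment is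
    -- not needed.
    have hlim : Tendsto (fun r : ℝ => τ j / 2 * r ^ 2) (𝓝[>] D j) (𝓝 (τ j / 2 * D j ^ 2)) :=
      ((continuous_const.mul (continuous_id.pow 2)).tendsto _).mono_left nhdsWithin_le_nhds
    refine ge_of_tendsto hlim (eventually_nhdsWithin_of_forall fun r hr => ?_)
    obtain ⟨w, hw, hlt⟩ := (Metric.infDist_lt_iff hκ.nonempty).1 (show D j < r from hr)
    have := hτ j
    refine (key w hw).trans ?_
    gcongr
  -- Growth bounds `δ (j + 1)` below in `hstep`, giving `(τ j + κ) * D (j + 1) ^ 2 ≤ τ j * D j ^ 2`.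
  have hcontr : ∀ j, D (j + 1) ^ 2 ≤ D j ^ 2 / c := by
    intro j
    rw [le_div_iff₀ hc]
    have h1 := hstep j
    have h2 := hgrow (j + 1)
    have h3 := mul_le_mul_of_nonneg_right (hcτ j) (sq_nonneg (D (j + 1)))
    refine le_of_mul_le_mul_left ?_ (hτ j)
    linarith
  have hdist : ∀ j, D j ^ 2 ≤ Metric.diam (effDom (fenchelConj ω)) ^ 2 / c ^ j := by
    intro j
    induction j with
    | zero =>
      have h1 : D 0 ≤ Metric.diam (effDom (fenchelConj ω)) :=
        (Metric.infDist_le_dist_of_mem hvb).trans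
          (Metric.dist_le_diam_of_mem (isBounded_effDom hK) (hd 0) (argmin_dualObj (hd 0) hvb).1)
      rw [pow_zero, div_one]
      have := hD0 0
      gcongr
    | succ j ih =>
      refine (hcontr j).trans ?_
      rw [pow_succ c, ← div_div]
      gcongr
  refine ⟨hdist j, ?_⟩
  have h1 := hstep j
  have h2 : τ j / 2 * D j ^ 2 ≤ τ j / 2 * (Metric.diam (effDom (fenchelConj ω)) ^ 2 / c ^ j) := by
    have := hτ j
    gcongr
    exact hdist j
  have h3 : 0 ≤ τ j / 2 * D (j + 1) ^ 2 := by have := hτ j; positivity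
  change δ (j + 1) ≤ _
  linarith

/-- Linear convergence of the duality gap in the inner loop. -/
lemma IsInnerLoop.dualityGap_le {K : NNReal} (hω : ConvexOn ℝ Set.univ ω)
    (hK : LipschitzWith K ω) (hlam : 0 < lam)
    {τ : ℕ → ℝ} {v : ℕ → Euc m} {z : ℕ → Euc n} (h : IsInnerLoop ω A lam y τ v z)
    {κ : ℝ} (hκ : HasQuadraticGrowth (dualObj ω A lam y) κ) {c : ℝ} (hc : 1 ≤ c)
    (hcτ : ∀ j, τ j * c ≤ τ j + κ) {τmax Lmin : ℝ} (hτ : ∀ j, τ j ≤ τmax)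
    (hlam' : lam ≤ Lmin⁻¹) (j : ℕ) :
    dualityGap ω A lam y (z (j + 1)) (v (j + 1)) ≤
      ((Metric.diam (effDom (fenchelConj ω)) * (2 * ‖A‖ * K * √(τmax / Lmin)
        + 1 / 2 * τmax * Metric.diam (effDom (fenchelConj ω))) / √c ^ j : ℝ) : EReal) := by
  obtain ⟨vb, hvb⟩ := hκ.nonempty
  have hd := h.mem_effDom hlam (j + 1)
  rw [h.primal, dualityGap_eq hd, EReal.coe_le_coe_iff]
  set C := Metric.diam (effDom (fenchelConj ω)) with hC
  have hC0 : 0 ≤ C := Metric.diam_nonneg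
  have hc0 : 0 < c := zero_lt_one.trans_le hc
  have hτm : 0 < τmax := (h.tau_pos 0).trans_le (hτ 0)
  have hδ : conjReal ω (v (j + 1)) + dualQuad lam y (A.adjoint (v (j + 1)))
        - (conjReal ω vb + dualQuad lam y (A.adjoint vb)) ≤ τmax / 2 * (C ^ 2 / c ^ j) := by
    refine (h.dist_subopt_le hK hlam hκ hc0 hcτ hvb j).2.trans ?_
    gcongr
    exact hτ j
  have hs : 0 < √c ^ j := by positivity
  have hcj : c ^ j = (√c ^ j) ^ 2 := by rw [← pow_mul, mul_comm, pow_mul, Real.sq_sqrt hc0.le]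
  have hs1 : 1 ≤ √c ^ j := one_le_pow₀ (Real.one_le_sqrt.2 hc)
  refine (gap_le_of_subopt hω hK hlam hd hvb hδ).trans ?_
  have h1 : √(2 * lam * (τmax / 2 * (C ^ 2 / c ^ j))) ≤ √(τmax / Lmin) * (C / √c ^ j) := by
    rw [← Real.sqrt_sq (by positivity : 0 ≤ C / √c ^ j), ← Real.sqrt_mul' _ (sq_nonneg _)]
    refine Real.sqrt_le_sqrt ?_
    rw [div_pow, ← hcj]
    calc _ = lam * (τmax * (C ^ 2 / c ^ j)) := by ring
      _ ≤ Lmin⁻¹ * (τmax * (C ^ 2 / c ^ j)) := by gcongr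
      _ = _ := by ring
  -- The suboptimality term decays at the faster rate `c ^ j`; it is weakened to share the rate `√c
  -- ^ j` of the square-root term.
  have h2 : C ^ 2 / c ^ j ≤ C ^ 2 / √c ^ j := by
    rw [hcj]
    refine div_le_div_of_nonneg_left (sq_nonneg C) hs ?_
    nlinarith
  calc _ ≤ 2 * ‖A‖ * K * (√(τmax / Lmin) * (C / √c ^ j)) + τmax / 2 * (C ^ 2 / √c ^ j) := by
        gcongr
    _ = _ := by ring

end InnerLoop

/-! ### One inexact proximal gradient step -/

/-- The fundamental inequality of one inexact proximal gradient step. -/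
lemma IsInexactProxGrad.three_point {n : ℕ} {f g : Euc n → ℝ} {ε B ρ : ℝ} {x y : Euc n}
    (hf : ConvexOn ℝ Set.univ f) (hd : Differentiable ℝ f)
    (h : IsInexactProxGrad f g ε (B + ρ) y x) (hls : bregman f x y ≤ B / 2 * ‖x - y‖ ^ 2)
    (z : Euc n) :
    f x + g x + (B + ρ) / 2 * ‖z - x‖ ^ 2
      ≤ f z + g z + (B + ρ) / 2 * ‖z - y‖ ^ 2 + (ε - ρ / 2 * ‖x - y‖ ^ 2) := by
  obtain ⟨s, hs, h0⟩ := h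
  have h1 := hs z
  have h2 := hf.add_inner_gradient_le (hd y) z
  have hs' : s = (B + ρ) • (y - x) - gradient f y := by
    rw [← sub_eq_zero, ← h0]; abel
  unfold bregman at hls
  have e1 : inner ℝ (gradient f y) (z - y)
      = inner ℝ (gradient f y) (z - x) + inner ℝ (gradient f y) (x - y) := by
    rw [← inner_add_right]; congr 1; abel
  have e2 : ‖z - y‖ ^ 2 = ‖z - x‖ ^ 2 + 2 * inner ℝ (z - x) (x - y) + ‖x - y‖ ^ 2 := by
    rw [← norm_add_sq_real]; congr 2; abel
  have e3 : inner ℝ (y - x) (z - x) = - inner ℝ (z - x) (x - y) := by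
    rw [real_inner_comm, ← inner_neg_right, neg_sub]
  rw [hs', inner_sub_left, real_inner_smul_left, e3] at h1
  -- The cosine identity is used with the full weight `B + ρ` but the line search costs only `B`;
  -- the surplus `ρ / 2 * ‖x - y‖ ^ 2` reduces the error.
  linear_combination h1 + h2 + hls - e1 - (B + ρ) / 2 * e2

/-- The stationarity residual of an inexact proximal gradient step. -/
lemma IsInexactProxGrad.infEDist_le {n : ℕ} {f g F : Euc n → ℝ} {ε L r : ℝ} {x y : Euc n}
    (hf : IsLipschitzSmooth f L) (hF : ∀ u, F u = f u + g u) (hr : 0 ≤ r)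
    (h : IsInexactProxGrad f g ε r y x) :
    Metric.infEDist 0 (epsSubdiff F ε x) ≤ ENNReal.ofReal ((L + r) * ‖x - y‖) := by
  obtain ⟨s, hs, h0⟩ := h
  -- Since `s = r • (y - x) - gradient f y`, this element is a gradient difference plus `r • (y -
  -- x)`, hence small with `‖x - y‖`.
  have hmem : gradient f x + s ∈ epsSubdiff F ε x := by
    intro u
    rw [hF, hF, inner_add_left]
    have h1 := hs u
    have h2 := hf.convex.add_inner_gradient_le (hf.differentiable x) u
    linarith
  refine (Metric.infEDist_le_edist_of_mem hmem).trans ?_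
  rw [edist_comm, edist_dist, dist_zero_right]
  refine ENNReal.ofReal_le_ofReal ?_
  have e : gradient f x + s = (gradient f x - gradient f y) + r • (y - x) := by
    rw [← sub_eq_zero, ← h0]; abel
  rw [e]
  refine (norm_add_le _ _).trans ?_
  rw [norm_smul, Real.norm_of_nonneg hr, norm_sub_rev y x, add_mul]
  gcongr
  exact hf.norm_gradient_sub_le x y

/-! ### Momentum and error schedule -/

section Schedule

variable {α Ls ρ ε d : ℕ → ℝ} {E₀ p Lmin Lmax : ℝ}

lemma IsOptimalSchedule.Ls_pos (h : IsOptimalSchedule α Ls ρ ε d E₀ p Lmin Lmax) (k : ℕ) :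
    0 < Ls k := h.Lmin_pos.trans_le (h.Lmin_le k)

lemma betaSeq_zero : betaSeq α Ls 0 = 1 := by simp [betaSeq]

/-- Under the optimal momentum rule the two arguments of the maximum coincide. -/
lemma IsOptimalSchedule.betaSeq_succ (h : IsOptimalSchedule α Ls ρ ε d E₀ p Lmin Lmax) (k : ℕ) :
    betaSeq α Ls (k + 1) = betaSeq α Ls k * (1 - α (k + 1)) := by
  unfold betaSeq
  rw [Finset.prod_range_succ, ← h.alpha_succ, max_self]

lemma IsOptimalSchedule.one_sub_alpha_pos (h : IsOptimalSchedule α Ls ρ ε d E₀ p Lmin Lmax)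
    (hα : ∀ k, 0 < α k) (k : ℕ) : 0 < 1 - α (k + 1) := by
  rw [h.alpha_succ]
  have := hα k
  have := hα (k + 1)
  have := h.Ls_pos k
  have := h.Ls_pos (k + 1)
  positivity

lemma IsOptimalSchedule.betaSeq_pos (h : IsOptimalSchedule α Ls ρ ε d E₀ p Lmin Lmax)
    (hα : ∀ k, 0 < α k) (k : ℕ) : 0 < betaSeq α Ls k := by
  induction k with
  | zero => rw [betaSeq_zero]; exact one_pos
  | succ k ih => rw [h.betaSeq_succ]; exact mul_pos ih (h.one_sub_alpha_pos hα k)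

/-- The ratios in `β` telescope, starting from `α 0 = 1`. -/
lemma IsOptimalSchedule.alpha_sq_mul (h : IsOptimalSchedule α Ls ρ ε d E₀ p Lmin Lmax)
    (hα : ∀ k, 0 < α k) (k : ℕ) : α k ^ 2 * Ls k = betaSeq α Ls k * Ls 0 := by
  induction k with
  | zero => rw [betaSeq_zero, h.alpha_zero]; ring
  | succ k ih =>
    have h1 := h.alpha_succ k
    have h2 : α k ^ 2 * Ls k ≠ 0 := by
      have := hα k
      have := h.Ls_pos k
      positivity
    rw [eq_div_iff h2] at h1
    rw [h.betaSeq_succ, ← h1, ih]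
    ring

/-- Here `b, b'` are consecutive values of `√β` and `s = √(Ls 0 / Ls (k + 1))`. The reciprocals
differ by `s * b / (b + b')`, which lies between `s / 2` and `s` because `b' ≤ b`. -/
lemma inv_add_half_le_and_le {b b' s : ℝ} (hb' : 0 < b') (hle : b' ≤ b)
    (hs : 0 ≤ s) (h : (b - b') * (b + b') = b ^ 2 * b' * s) :
    b⁻¹ + s / 2 ≤ b'⁻¹ ∧ b'⁻¹ ≤ b⁻¹ + s := by
  have hb : 0 < b := hb'.trans_le hle
  have h1 : b'⁻¹ - b⁻¹ = s * (b / (b + b')) := by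
    have : (b + b') ≠ 0 := by positivity
    field_simp
    linear_combination h
  have h2 : 1 / 2 ≤ b / (b + b') := by rw [div_le_div_iff₀ two_pos (by positivity)]; linarith
  have h3 : b / (b + b') ≤ 1 := by rw [div_le_one (by positivity)]; linarith
  have h4 := mul_le_mul_of_nonneg_left h2 hs
  have h5 := mul_le_mul_of_nonneg_left h3 hs
  constructor <;> linarith

/-- The step parameter as a multiple of the square root of `β`. -/
lemma IsOptimalSchedule.alpha_eq (h : IsOptimalSchedule α Ls ρ ε d E₀ p Lmin Lmax)
    (hα : ∀ k, 0 < α k) (k : ℕ) : α k = √(betaSeq α Ls k) * √(Ls 0 / Ls k) := by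
  have h1 := h.alpha_sq_mul hα k
  have h2 := h.Ls_pos k
  rw [← Real.sqrt_mul (h.betaSeq_pos hα k).le, mul_div_assoc', ← h1, mul_div_cancel_right₀ _ h2.ne',
    Real.sqrt_sq (hα k).le]

/-- Two-sided linear growth of `β_k^{-1/2}`. -/
lemma IsOptimalSchedule.inv_sqrt_betaSeq (h : IsOptimalSchedule α Ls ρ ε d E₀ p Lmin Lmax)
    (hα : ∀ k, 0 < α k) (k : ℕ) :
    1 + 1 / 2 * √(Ls 0 / Lmax) * k ≤ (√(betaSeq α Ls k))⁻¹ ∧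
      (√(betaSeq α Ls k))⁻¹ ≤ 1 + √(Ls 0 / Lmin) * k := by
  induction k with
  | zero => simp [betaSeq_zero]
  | succ k ih =>
    have hb := h.betaSeq_pos hα k
    have hb' := h.betaSeq_pos hα (k + 1)
    have hL0 := h.Ls_pos 0
    have hL := h.Ls_pos (k + 1)
    have hLm := h.Lmin_pos
    have hsucc := h.betaSeq_succ k
    have key := inv_add_half_le_and_le (b := √(betaSeq α Ls k)) (b' := √(betaSeq α Ls (k + 1)))
      (s := √(Ls 0 / Ls (k + 1))) (Real.sqrt_pos.2 hb')
      (Real.sqrt_le_sqrt (by rw [hsucc]; nlinarith [hα (k + 1)])) (Real.sqrt_nonneg _) (by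
        rw [mul_assoc, ← h.alpha_eq hα, Real.sq_sqrt hb.le]
        have e1 := Real.sq_sqrt hb.le
        have e2 := Real.sq_sqrt hb'.le
        linear_combination e1 - e2 - hsucc)
    have h1 : √(Ls 0 / Lmax) ≤ √(Ls 0 / Ls (k + 1)) :=
      Real.sqrt_le_sqrt (div_le_div_of_nonneg_left hL0.le hL (h.le_Lmax _))
    have h2 : √(Ls 0 / Ls (k + 1)) ≤ √(Ls 0 / Lmin) :=
      Real.sqrt_le_sqrt (div_le_div_of_nonneg_left hL0.le hLm (h.Lmin_le _))
    push_cast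
    constructor
    · linarith [key.1, ih.1]
    · linarith [key.2, ih.2]

lemma IsOptimalSchedule.sqrt_betaSeq_le (h : IsOptimalSchedule α Ls ρ ε d E₀ p Lmin Lmax)
    (hα : ∀ k, 0 < α k) {k : ℕ} (hk : 1 ≤ k) :
    √(betaSeq α Ls k) ≤ 1 / (1 / 2 * √(Ls 0 / Lmax) * k) := by
  have hb := Real.sqrt_pos.2 (h.betaSeq_pos hα k)
  have h1 := (h.inv_sqrt_betaSeq hα k).1
  have hk' : (1 : ℝ) ≤ k := by exact_mod_cast hk
  have hL0 := h.Ls_pos 0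
  have hLmax : 0 < Lmax := hL0.trans_le (h.le_Lmax 0)
  have h2 : 0 < 1 / 2 * √(Ls 0 / Lmax) * k := by positivity
  rw [one_div, le_inv_comm₀ hb h2]
  linarith

lemma IsOptimalSchedule.le_betaSeq (h : IsOptimalSchedule α Ls ρ ε d E₀ p Lmin Lmax)
    (hα : ∀ k, 0 < α k) {k : ℕ} (hk : 1 ≤ k) :
    Lmin / Ls 0 / (4 * (k : ℝ) ^ 2) ≤ betaSeq α Ls k := by
  have hb := h.betaSeq_pos hα k
  have hsb := Real.sqrt_pos.2 hb
  have h1 := (h.inv_sqrt_betaSeq hα k).2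
  have hk' : (1 : ℝ) ≤ k := by exact_mod_cast hk
  have hL0 := h.Ls_pos 0
  have hLm := h.Lmin_pos
  have h2 : 1 ≤ √(Ls 0 / Lmin) := Real.one_le_sqrt.2 ((one_le_div hLm).2 (h.Lmin_le 0))
  have h3 : (√(betaSeq α Ls k))⁻¹ ≤ √(Ls 0 / Lmin) * (2 * k) := by nlinarith
  have h4 := pow_le_pow_left₀ (by positivity) h3 2
  rw [inv_pow, Real.sq_sqrt hb.le, mul_pow, Real.sq_sqrt (by positivity)] at h4
  rw [inv_le_comm₀ hb (by positivity)] at h4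
  refine le_trans (le_of_eq ?_) h4
  field_simp
  ring

lemma IsOptimalSchedule.sum_le_errorSum (h : IsOptimalSchedule α Ls ρ ε d E₀ p Lmin Lmax) (k : ℕ) :
    E₀ * (1 + ∑ l ∈ Finset.range k, 1 / ((l : ℝ) + 1) ^ p) ≤ errorSum E₀ p := by
  have hs : Summable fun l : ℕ => 1 / ((l : ℝ) + 1) ^ p := by
    have := (summable_nat_add_iff 1).2 (Real.summable_one_div_nat_rpow.2 h.one_lt_p)
    simpa using this
  unfold errorSum
  have := h.E_pos
  gcongr
  exact hs.sum_le_tsum _ fun l _ => by positivity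

lemma IsOptimalSchedule.errorSum_pos (h : IsOptimalSchedule α Ls ρ ε d E₀ p Lmin Lmax) :
    0 < errorSum E₀ p := by
  have h1 := h.sum_le_errorSum 0
  have := h.E_pos
  simp at h1
  linarith

/-- Lower bound for the tolerances. -/
lemma IsOptimalSchedule.le_eps (h : IsOptimalSchedule α Ls ρ ε d E₀ p Lmin Lmax)
    (hα : ∀ k, 0 < α k) (hρ : ∀ k, 0 ≤ ρ k) {k : ℕ} (hk : 1 ≤ k) :
    E₀ * (Lmin / Ls 0) / (4 * (k : ℝ) ^ (2 + p)) ≤ ε k := by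
  rw [h.eps_eq k hk]
  have hk' : (0 : ℝ) < k := by exact_mod_cast hk
  have h1 := h.le_betaSeq hα hk
  have h2 : 0 ≤ ρ k / 2 * d k ^ 2 := by have := hρ k; positivity
  have hE := h.E_pos
  have h3 : E₀ * (Lmin / Ls 0 / (4 * (k : ℝ) ^ 2)) / (k : ℝ) ^ p
      ≤ E₀ * betaSeq α Ls k / (k : ℝ) ^ p := by gcongr
  refine le_trans (le_of_eq ?_) (h3.trans (le_add_of_nonneg_right h2))
  rw [Real.rpow_add hk', Real.rpow_two]
  field_simp

end Schedule

/-! ### Convergence rates of the outer loop -/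

section Outer

variable {n : ℕ} {f g F : Euc n → ℝ} {L : ℝ} {α B ρ ε Ls : ℕ → ℝ} {xinit xoinit xbar : Euc n}
  {x y xo : ℕ → Euc n} {E₀ p Lmin Lmax : ℝ}

lemma IsIAPG.x_eq (h : IsIAPG f g α B ρ ε xinit xoinit x y xo) (k : ℕ) :
    x k = α k • xo k + (1 - α k) • prevSeq xinit x k := by
  rw [h.xo_eq k, smul_add, smul_smul, mul_inv_cancel₀ (h.alpha_pos k).ne', one_smul, sub_smul,
    one_smul]
  abel

/-- `x k` and `y k` are combinations with the same weights and the same second point, so only the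
auxiliary iterates survive. -/
lemma IsIAPG.x_sub_y (h : IsIAPG f g α B ρ ε xinit xoinit x y xo) (k : ℕ) :
    x k - y k = α k • (xo k - prevSeq xoinit xo k) := by
  rw [h.y_eq k, smul_sub]
  nth_rewrite 1 [h.x_eq k]
  abel

/-- The one-step Lyapunov inequality. -/
lemma IsIAPG.lyapunov_step (h : IsIAPG f g α B ρ ε xinit xoinit x y xo)
    (hf : IsLipschitzSmooth f L) (hg : ConvexOn ℝ Set.univ g) (hF : ∀ u, F u = f u + g u)
    (hLs : ∀ k, Ls k = B k + ρ k) (k : ℕ) :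
    F (x k) - F xbar + α k ^ 2 * Ls k / 2 * ‖xbar - xo k‖ ^ 2
      ≤ (1 - α k) * (F (prevSeq xinit x k) - F xbar)
        + α k ^ 2 * Ls k / 2 * ‖xbar - prevSeq xoinit xo k‖ ^ 2
        + (ε k - ρ k / 2 * ‖x k - y k‖ ^ 2) := by
  set a := α k with ha
  -- With this comparison point, both `z - x k` and `z - y k` are `α k` times differences of
  -- auxiliary iterates with `xbar`.
  set z := a • xbar + (1 - a) • prevSeq xinit x k with hz
  have h0 := h.alpha_pos k
  have h1 := h.alpha_le_one k
  have h2 := (h.x_inexact k).three_point hf.convex hf.differentiable (h.lineSearch k) z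
  have hFc : ConvexOn ℝ Set.univ F := by
    have : F = f + g := funext hF
    rw [this]; exact hf.convex.add hg
  have h3 : F z ≤ a * F xbar + (1 - a) * F (prevSeq xinit x k) :=
    hFc.2 (Set.mem_univ _) (Set.mem_univ _) h0.le (sub_nonneg.2 h1) (by ring)
  have e1 : z - x k = a • (xbar - xo k) := by
    rw [h.x_eq k, hz, smul_sub]; abel
  have e2 : z - y k = a • (xbar - prevSeq xoinit xo k) := by
    rw [h.y_eq k, hz, smul_sub]; abel
  rw [e1, e2, norm_smul, norm_smul, mul_pow, mul_pow, Real.norm_eq_abs, sq_abs, ← hF, ← hF,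
    ← hLs] at h2
  linarith

/-- The global Lyapunov estimate. -/
lemma IsIAPG.lyapunov (h : IsIAPG f g α B ρ ε xinit xoinit x y xo)
    (hf : IsLipschitzSmooth f L) (hg : ConvexOn ℝ Set.univ g) (hF : ∀ u, F u = f u + g u)
    (hLs : ∀ k, Ls k = B k + ρ k)
    (hs : IsOptimalSchedule α Ls ρ ε (fun k => ‖x k - y k‖) E₀ p Lmin Lmax) (k : ℕ) :
    F (x k) - F xbar + betaSeq α Ls k * (Ls 0 / 2 * ‖xbar - xo k‖ ^ 2)
      ≤ betaSeq α Ls k * (Ls 0 / 2 * ‖xbar - xoinit‖ ^ 2 + errorSum E₀ p) := by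
  have hβ := hs.betaSeq_pos h.alpha_pos
  have key : F (x k) - F xbar + betaSeq α Ls k * (Ls 0 / 2 * ‖xbar - xo k‖ ^ 2)
      ≤ betaSeq α Ls k * (Ls 0 / 2 * ‖xbar - xoinit‖ ^ 2
        + E₀ * (1 + ∑ l ∈ Finset.range k, 1 / ((l : ℝ) + 1) ^ p)) := by
    induction k with
    | zero =>
      -- `α 0 = 1` removes the value at the arbitrary starting point `xinit`.
      have h1 := h.lyapunov_step (xbar := xbar) hf hg hF hLs 0
      have h2 : 0 ≤ ρ 0 / 2 * ‖x 0 - y 0‖ ^ 2 := by have := h.rho_nonneg 0; positivity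
      rw [hs.alpha_zero, hs.eps_zero] at h1
      simp only [prevSeq] at h1
      rw [betaSeq_zero]
      simp
      linarith
    | succ k ih =>
      have h1 := h.lyapunov_step (xbar := xbar) hf hg hF hLs (k + 1)
      rw [hs.alpha_sq_mul h.alpha_pos, hs.eps_eq (k + 1) (by omega)] at h1
      simp only [prevSeq] at h1
      have hp := hs.one_sub_alpha_pos h.alpha_pos k
      -- Multiplication by `1 - α (k + 1)` turns `β_k` into `β_(k+1)`; the new error is exactly
      -- `β_(k+1) E₀ (k+1)^(-p)`.
      have h2 := mul_le_mul_of_nonneg_left ih hp.le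
      have h3 := hs.betaSeq_succ k
      rw [Finset.sum_range_succ]
      push_cast at h1
      rw [h3] at h1 ⊢
      linear_combination h1 + h2
  refine key.trans (mul_le_mul_of_nonneg_left ?_ (hβ k).le)
  have := hs.sum_le_errorSum k
  linarith

/-- Sublinear rate for the function values. -/
lemma IsIAPG.value_le (h : IsIAPG f g α B ρ ε xinit xoinit x y xo)
    (hf : IsLipschitzSmooth f L) (hg : ConvexOn ℝ Set.univ g) (hF : ∀ u, F u = f u + g u)
    (hLs : ∀ k, Ls k = B k + ρ k)
    (hs : IsOptimalSchedule α Ls ρ ε (fun k => ‖x k - y k‖) E₀ p Lmin Lmax) {k : ℕ} (hk : 1 ≤ k) :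
    F (x k) - F xbar
      ≤ (√(Ls 0 / 2 * ‖xbar - xoinit‖ ^ 2 + errorSum E₀ p)
          / (1 / 2 * √(Ls 0 / Lmax) * k)) ^ 2 := by
  have hb := hs.betaSeq_pos h.alpha_pos k
  have hL0 := hs.Ls_pos 0
  have hR := hs.errorSum_pos
  have h1 := h.lyapunov (xbar := xbar) hf hg hF hLs hs k
  have h2 : 0 ≤ betaSeq α Ls k * (Ls 0 / 2 * ‖xbar - xo k‖ ^ 2) := by positivity
  have h3 := pow_le_pow_left₀ (Real.sqrt_nonneg _) (hs.sqrt_betaSeq_le h.alpha_pos hk) 2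
  rw [Real.sq_sqrt hb.le] at h3
  rw [div_pow, Real.sq_sqrt (by positivity)]
  rw [div_pow, one_pow] at h3
  set C := Ls 0 / 2 * ‖xbar - xoinit‖ ^ 2 + errorSum E₀ p with hC
  have hC0 : 0 ≤ C := by positivity
  calc _ ≤ betaSeq α Ls k * C := by linarith
    _ ≤ 1 / (1 / 2 * √(Ls 0 / Lmax) * k) ^ 2 * C := by gcongr
    _ = _ := by ring

/-- Boundedness of the auxiliary iterates. -/
lemma IsIAPG.norm_sub_xo_le (h : IsIAPG f g α B ρ ε xinit xoinit x y xo)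
    (hf : IsLipschitzSmooth f L) (hg : ConvexOn ℝ Set.univ g) (hF : ∀ u, F u = f u + g u)
    (hxbar : ∀ u, F xbar ≤ F u) (hLs : ∀ k, Ls k = B k + ρ k)
    (hs : IsOptimalSchedule α Ls ρ ε (fun k => ‖x k - y k‖) E₀ p Lmin Lmax) (k : ℕ) :
    ‖xbar - xo k‖ ≤ ‖xbar - xoinit‖ + √(2 * errorSum E₀ p / Ls 0) := by
  have hb := hs.betaSeq_pos h.alpha_pos k
  have hL0 := hs.Ls_pos 0
  have hR := hs.errorSum_pos
  have h1 := h.lyapunov (xbar := xbar) hf hg hF hLs hs k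
  -- Minimality of `xbar` lets the value gap be dropped from the energy.
  have h2 : Ls 0 / 2 * ‖xbar - xo k‖ ^ 2 ≤ Ls 0 / 2 * ‖xbar - xoinit‖ ^ 2 + errorSum E₀ p := by
    refine le_of_mul_le_mul_left ?_ hb
    linarith [hxbar (x k)]
  have h3 : ‖xbar - xo k‖ ^ 2 ≤ ‖xbar - xoinit‖ ^ 2 + 2 * errorSum E₀ p / Ls 0 := by
    refine le_of_mul_le_mul_left (h2.trans (le_of_eq ?_)) (half_pos hL0)
    field_simp
  refine abs_le_of_sq_le_sq' ?_ (by positivity) |>.2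
  rw [add_sq, Real.sq_sqrt (by positivity)]
  have : 0 ≤ 2 * ‖xbar - xoinit‖ * √(2 * errorSum E₀ p / Ls 0) := by positivity
  linarith

/-- Sublinear rate for the residual `‖x_k - y_k‖`. -/
lemma IsIAPG.norm_x_sub_y_le (h : IsIAPG f g α B ρ ε xinit xoinit x y xo)
    (hf : IsLipschitzSmooth f L) (hg : ConvexOn ℝ Set.univ g) (hF : ∀ u, F u = f u + g u)
    (hxbar : ∀ u, F xbar ≤ F u) (hLs : ∀ k, Ls k = B k + ρ k)
    (hs : IsOptimalSchedule α Ls ρ ε (fun k => ‖x k - y k‖) E₀ p Lmin Lmax)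
    {k : ℕ} (hk : 1 ≤ k) :
    ‖x k - y k‖
      ≤ 4 * (‖xbar - xoinit‖ + √(2 * errorSum E₀ p / Ls 0)) * √(Lmax / Lmin) / k := by
  obtain ⟨k, rfl⟩ : ∃ l, k = l + 1 := ⟨k - 1, by omega⟩
  set C := ‖xbar - xoinit‖ + √(2 * errorSum E₀ p / Ls 0) with hC
  have hC0 : 0 ≤ C := by positivity
  have hL0 := hs.Ls_pos 0
  have hLm := hs.Lmin_pos
  have hLk := hs.Ls_pos (k + 1)
  have hLmax : 0 < Lmax := hL0.trans_le (hs.le_Lmax 0)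
  have hb := h.norm_sub_xo_le hf hg hF hxbar hLs hs
  have h1 : ‖xo (k + 1) - xo k‖ ≤ 2 * C := by
    have e : xo (k + 1) - xo k = (xbar - xo k) - (xbar - xo (k + 1)) := by abel
    rw [e]
    exact (norm_sub_le _ _).trans (by linarith [hb k, hb (k + 1)])
  have h2 : α (k + 1) ≤ 2 * √(Lmax / Lmin) / ((k + 1 : ℕ) : ℝ) := by
    rw [hs.alpha_eq h.alpha_pos]
    have h3 := hs.sqrt_betaSeq_le h.alpha_pos hk
    have h4 : √(Ls 0 / Ls (k + 1)) ≤ √(Ls 0 / Lmin) :=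
      Real.sqrt_le_sqrt (div_le_div_of_nonneg_left hL0.le hLm (hs.Lmin_le _))
    have h5 : √(Ls 0 / Lmin) = √(Lmax / Lmin) * √(Ls 0 / Lmax) := by
      rw [← Real.sqrt_mul (by positivity)]; congr 1; field_simp
    have h6 : 0 < √(Ls 0 / Lmax) := by positivity
    calc _ ≤ 1 / (1 / 2 * √(Ls 0 / Lmax) * ((k + 1 : ℕ) : ℝ)) * √(Ls 0 / Lmin) := by gcongr
      _ = _ := by rw [h5]; field_simp
  rw [h.x_sub_y, norm_smul, Real.norm_of_nonneg (h.alpha_pos _).le]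
  simp only [prevSeq]
  calc _ ≤ 2 * √(Lmax / Lmin) / ((k + 1 : ℕ) : ℝ) * (2 * C) := by
        gcongr
    _ = _ := by ring

end Outer

/-! ### Ceilings and logarithms in the explicit bounds -/

/-- Separates the constant from the accuracy in the outer iteration count; this is the origin of the
ceilings in `C₆`, `C₇`, `C₈` and of the maxima with `1`. -/
lemma natCeil_mul_le {a s : ℝ} (hs : 0 ≤ s) :
    (⌈a * s⌉₊ : ℝ) ≤ ⌈a⌉₊ * max 1 (2 * s) := by
  have h1 : ⌈a * s⌉₊ ≤ ⌈a⌉₊ * ⌈s⌉₊ := by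
    rw [Nat.ceil_le]
    push_cast
    exact mul_le_mul (Nat.le_ceil a) (Nat.le_ceil s) hs (Nat.cast_nonneg _)
  have h2 : (⌈s⌉₊ : ℝ) ≤ max 1 (2 * s) := by
    rcases le_total s 1 with h | h
    · refine le_max_of_le_left ?_
      exact_mod_cast Nat.ceil_le.2 (by simpa using h)
    · refine le_max_of_le_right ?_
      linarith [Nat.ceil_lt_add_one hs]
  calc (⌈a * s⌉₊ : ℝ) ≤ ⌈a⌉₊ * ⌈s⌉₊ := by exact_mod_cast h1
    _ ≤ _ := by gcongr

/-- `Q = 0` is allowed: the conclusion is then trivial, whatever `Real.log 0` is. -/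
lemma le_sqrt_pow_of_log_le {c Q : ℝ} {M : ℕ} (hc : 1 < c) (hQ : 0 ≤ Q)
    (h : 2 * Real.log Q / Real.log c ≤ M) : Q ≤ √c ^ M := by
  have hs : 0 < √c ^ M := pow_pos (Real.sqrt_pos.2 (zero_lt_one.trans hc)) M
  rcases hQ.eq_or_lt with h0 | h0
  · rw [← h0]; exact hs.le
  · rw [div_le_iff₀ (Real.log_pos hc)] at h
    rw [← Real.log_le_log_iff h0 hs, Real.log_pow, Real.log_sqrt (zero_lt_one.trans hc).le]
    linarith

lemma log_mul_rpow_inv {T C q : ℝ} (hT : 0 < T) (hC : 0 < C) (hq : 0 < q) :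
    q * Real.log (T * C ^ (1 / q)) = Real.log (C * T ^ q) := by
  rw [Real.log_mul hT.ne' (by positivity), Real.log_rpow hC, Real.log_mul hC.ne' (by positivity),
    Real.log_rpow hT]
  field_simp
  ring

/-- The argument on the left is a square, which is why the value bound carries `2 + p` and `4 / e`
where the other bounds carry `2 * (2 + p)` and `2 / e`. -/
lemma log_max_mul_sq {C T e q : ℝ} (he : 0 < e) (hC : 0 ≤ C) :
    Real.log (max 1 (4 / e) * (T ^ 2 * C ^ (2 / q)))
      = 2 * Real.log (T * max 1 (2 * e ^ (-(1 / 2) : ℝ)) * C ^ (1 / q)) := by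
  have h1 : (2 * e ^ (-(1 / 2) : ℝ)) ^ 2 = 4 / e := by
    rw [mul_pow, ← Real.rpow_natCast (e ^ _), ← Real.rpow_mul he.le]
    norm_num [Real.rpow_neg_one, div_eq_mul_inv]
  have h2 : (max 1 (2 * e ^ (-(1 / 2) : ℝ))) ^ 2 = max 1 (4 / e) := by
    rw [← h1]
    have h0 : 0 ≤ 2 * e ^ (-(1 / 2) : ℝ) := by positivity
    rcases le_total 1 (2 * e ^ (-(1 / 2) : ℝ)) with h | h
    · rw [max_eq_right h, max_eq_right (one_le_pow₀ h)]
    · rw [max_eq_left h, max_eq_left (pow_le_one₀ h0 h), one_pow]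
  have h3 : (C ^ (1 / q)) ^ 2 = C ^ (2 / q) := by
    rw [← Real.rpow_natCast, ← Real.rpow_mul hC]
    congr 1
    push_cast
    ring
  rw [← h2, ← h3, ← mul_pow, ← mul_pow, Real.log_pow]
  push_cast
  congr 2
  ring

/-! ### Asymptotics as the accuracy tends to zero -/

section BigO

lemma tendsto_log_one_div_nhdsGT_zero :
    Tendsto (fun e : ℝ => Real.log (1 / e)) (𝓝[>] 0) atTop := by
  simpa only [one_div, Function.comp_def] using Real.tendsto_log_atTop.comp tendsto_inv_nhdsGT_zero

lemma const_isBigO_log_one_div (c : ℝ) :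
    (fun _ : ℝ => c) =O[𝓝[>] 0] fun e => Real.log (1 / e) :=
  (isLittleO_const_left.2 (Or.inr
    (tendsto_norm_atTop_atTop.comp tendsto_log_one_div_nhdsGT_zero))).isBigO

lemma log_max_mul_isBigO {d C : ℝ} (hd : 0 < d) :
    (fun e : ℝ => Real.log (max 1 (d / e) * C)) =O[𝓝[>] 0] fun e => Real.log (1 / e) := by
  rcases eq_or_ne C 0 with rfl | hC
  · simpa using const_isBigO_log_one_div 0
  · refine ((const_isBigO_log_one_div (Real.log (d * C))).add
      (isBigO_refl (fun e : ℝ => Real.log (1 / e)) _)).congr' ?_ EventuallyEq.rfl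
    filter_upwards [Ioc_mem_nhdsGT hd] with e he
    have he0 : 0 < e := he.1
    rw [max_eq_right ((one_le_div he0).2 he.2), ← Real.log_mul (by positivity) (by positivity)]
    congr 1
    ring

/-- The ceiling and the maxima cost only an additive constant, negligible against `log (1 / e) → ∞`.
-/
lemma natCeil_max_isBigO {b c d C D : ℝ} (hd : 0 < d) :
    (fun e : ℝ => (⌈max 1 (max b (c * Real.log (max 1 (d / e) * C) / D))⌉₊ : ℝ))
      =O[𝓝[>] 0] fun e => Real.log (1 / e) := by
  have h1 : (fun e : ℝ => (2 + |b|) + ‖c / D * Real.log (max 1 (d / e) * C)‖)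
      =O[𝓝[>] 0] fun e => Real.log (1 / e) :=
    (const_isBigO_log_one_div _).add ((log_max_mul_isBigO hd).const_mul_left _).norm_left
  refine (IsBigO.of_bound 1 (Eventually.of_forall fun e => ?_)).trans h1
  set X := c * Real.log (max 1 (d / e) * C) / D with hX
  have e1 : c / D * Real.log (max 1 (d / e) * C) = X := by rw [hX]; ring
  rw [e1, Real.norm_natCast, one_mul, Real.norm_of_nonneg (by positivity), Real.norm_eq_abs]
  have h2 := Nat.ceil_lt_add_one (zero_le_one.trans (le_max_left 1 (max b X)))
  have h3 : max 1 (max b X) ≤ 1 + |b| + |X| := by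
    have := le_abs_self b
    have := le_abs_self X
    have := abs_nonneg b
    have := abs_nonneg X
    refine max_le (by linarith) (max_le (by linarith) (by linarith))
  linarith

lemma one_add_natCeil_isBigO {s a : ℝ} {q : ℝ → ℝ} (hs : 0 ≤ s) (ha : 0 ≤ a)
    (hq : ∀ e, 0 < e → q e = a * e ^ (-s)) :
    (fun e : ℝ => 1 + (⌈q e⌉₊ : ℝ)) =O[𝓝[>] 0] fun e => e ^ (-s) := by
  refine IsBigO.of_bound (2 + a) ?_
  filter_upwards [Ioc_mem_nhdsGT (zero_lt_one (α := ℝ))] with e he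
  have h1 : 1 ≤ e ^ (-s) := Real.one_le_rpow_of_pos_of_le_one_of_nonpos he.1 he.2 (by linarith)
  have h2 := Nat.ceil_lt_add_one (a := q e) (by rw [hq e he.1]; positivity)
  rw [Real.norm_of_nonneg (by positivity), Real.norm_of_nonneg (by positivity)]
  rw [hq e he.1] at h2 ⊢
  linarith

end BigO

/-! ### Total complexity -/

theorem mainTheorem1 {n m : ℕ}
    -- problem data: minimize F = f + ω ∘ A
    (f : Euc n → ℝ) (L : ℝ) (hf : IsLipschitzSmooth f L)
    (ω : Euc m → ℝ) (K : NNReal) (hωc : ConvexOn ℝ Set.univ ω) (hωK : LipschitzWith K ω)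
    (A : Euc n →L[ℝ] Euc m)
    (F : Euc n → ℝ) (hF : ∀ u, F u = f u + ω (A u))
    (xbar : Euc n) (hxbar : ∀ u, F xbar ≤ F u)
    -- outer loop, with the optimal momentum and error schedule
    (α B ρ ε Ls : ℕ → ℝ) (hLs : ∀ k, Ls k = B k + ρ k)
    (xinit xoinit : Euc n) (x y xo : ℕ → Euc n)
    (hIAPG : IsIAPG f (fun u => ω (A u)) α B ρ ε xinit xoinit x y xo)
    (E₀ p Lmin Lmax : ℝ)
    (hsched : IsOptimalSchedule α Ls ρ ε (fun k => ‖x k - y k‖) E₀ p Lmin Lmax)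
    -- inner loops: one run of dual proximal gradient descent for every outer iteration
    (lam : ℕ → ℝ) (hlam : ∀ k, lam k = (Ls k)⁻¹)
    (yt : ℕ → Euc n) (hyt : ∀ k, yt k = y k - (Ls k)⁻¹ • gradient f (y k))
    (τ : ℕ → ℕ → ℝ) (v : ℕ → ℕ → Euc m) (z : ℕ → ℕ → Euc n)
    (hinner : ∀ k, IsInnerLoop ω A (lam k) (yt k) (τ k) (v k) (z k))
    (κ : ℕ → ℝ) (hκ : ∀ k, HasQuadraticGrowth (dualObj ω A (lam k) (yt k)) (κ k))
    (κmin τmax : ℝ) (hκmin : 0 < κmin) (hκ_le : ∀ k, κmin ≤ κ k) (hτ_le : ∀ k j, τ k j ≤ τmax)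
    -- constants
    (C₁ C₂ C₃ CΨ Clam C₄ C₅ C₆ C₇ C₈ : ℝ)
    (hC₁ : C₁ = 1 / 2 * √(Ls 0 / Lmax))
    (hC₂ : C₂ = Ls 0 / 2 * ‖xbar - xoinit‖ ^ 2 + errorSum E₀ p)
    (hC₃ : C₃ = ‖xbar - xoinit‖ + √(2 * errorSum E₀ p / Ls 0))
    (hCΨ : CΨ = Metric.diam (effDom (fenchelConj ω)))
    (hClam : Clam = CΨ * (2 * ‖A‖ * K * √(τmax / Lmin) + 1 / 2 * τmax * CΨ))
    (hC₄ : C₄ = 1 + κmin / τmax)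
    (hC₅ : C₅ = Clam * √C₄ / E₀ * (Ls 0 / Lmin))
    (hC₆ : C₆ = (⌈√C₂ / C₁⌉₊ : ℝ) ^ 2 * (4 * C₅) ^ (2 / (2 + p)))
    (hC₇ : C₇ = (⌈4 * C₃ * √(Lmax / Lmin)⌉₊ : ℝ) * (4 * C₅) ^ (1 / (2 + p)))
    (hC₈ : C₈ = (⌈4 * C₃ * √(Lmax / Lmin) * (L + Lmax)⌉₊ : ℝ) * (4 * C₅) ^ (1 / (2 + p)))
    -- the explicit bounds, as functions of the target accuracy
    (N₁ N₂ N₃ : ℝ → ℝ)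
    (hN₁ : ∀ e, N₁ e = (1 + (⌈√C₂ * e ^ (-(1 / 2) : ℝ) / C₁⌉₊ : ℝ)) *
      (⌈max 1 (max (2 * Real.log C₅ / Real.log C₄)
        ((2 + p) * Real.log (max 1 (4 / e) * C₆) / Real.log C₄))⌉₊ : ℝ))
    (hN₂ : ∀ e, N₂ e = (1 + (⌈4 * C₃ * √(Lmax / Lmin) / e⌉₊ : ℝ)) *
      (⌈max 1 (max (2 * Real.log C₅ / Real.log C₄)
        (2 * (2 + p) * Real.log (max 1 (2 / e) * C₇) / Real.log C₄))⌉₊ : ℝ))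
    (hN₃ : ∀ e, N₃ e = (1 + (⌈4 * C₃ * √(Lmax / Lmin) * (L + Lmax) / e⌉₊ : ℝ)) *
      (⌈max 1 (max (2 * Real.log C₅ / Real.log C₄)
        (2 * (2 + p) * Real.log (max 1 (2 / e) * C₈) / Real.log C₄))⌉₊ : ℝ)) :
    -- every inner loop stops, after `J k` iterations
    ∃ J : ℕ → ℕ,
      (∀ k, IsLeast {t : ℕ | dualityGap ω A (lam k) (yt k) (z k t) (v k t) ≤ (ε k : EReal)} (J k)) ∧
      -- function value gap
      ((∀ e : ℝ, 0 < e → ∃ k : ℕ, F (x k) - F xbar ≤ e ∧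
          ∑ l ∈ Finset.range (k + 1), (J l : ℝ) ≤ N₁ e) ∧
        N₁ =O[𝓝[>] 0] fun e => e ^ (-(1 / 2) : ℝ) * Real.log (1 / e)) ∧
      -- termination criterion
      ((∀ e : ℝ, 0 < e → ∃ k : ℕ, ‖x k - y k‖ ≤ e ∧
          ∑ l ∈ Finset.range (k + 1), (J l : ℝ) ≤ N₂ e) ∧
        N₂ =O[𝓝[>] 0] fun e => e⁻¹ * Real.log (1 / e)) ∧
      -- stationarity
      ((∀ e : ℝ, 0 < e → ∃ k : ℕ,
          Metric.infEDist 0 (epsSubdiff F (ε k) (x k)) ≤ ENNReal.ofReal e ∧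
          ∑ l ∈ Finset.range (k + 1), (J l : ℝ) ≤ N₃ e) ∧
        N₃ =O[𝓝[>] 0] fun e => e⁻¹ * Real.log (1 / e)) := by
  have hα := hIAPG.alpha_pos
  have hg : ConvexOn ℝ Set.univ fun u => ω (A u) :=
    hωc.comp_linearMap (A : Euc n →ₗ[ℝ] Euc m)
  have hLpos := hsched.Ls_pos
  have hLm := hsched.Lmin_pos
  have hLmax : 0 < Lmax := (hLpos 0).trans_le (hsched.le_Lmax 0)
  have hE := hsched.E_pos
  have hp := hsched.one_lt_p
  have hR := hsched.errorSum_pos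
  have hτm : 0 < τmax := ((hinner 0).tau_pos 0).trans_le (hτ_le 0 0)
  have hC4 : 1 < C₄ := by rw [hC₄]; exact lt_add_of_pos_right 1 (by positivity)
  have hlogC4 := Real.log_pos hC4
  have hCΨ0 : 0 ≤ CΨ := hCΨ ▸ Metric.diam_nonneg
  have hClam0 : 0 ≤ Clam := by rw [hClam]; positivity
  have hL0 := hLpos 0
  have hC50 : 0 ≤ C₅ := by rw [hC₅]; positivity
  have hC1 : 0 < C₁ := by rw [hC₁]; positivity
  have hC2 : 0 < C₂ := by rw [hC₂]; positivity
  have hC3 : 0 < C₃ := by rw [hC₃]; positivity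
  have hr : 0 < √(Lmax / Lmin) := by positivity
  -- convergence of the inner loops
  have hgap : ∀ k M, 1 ≤ M → Clam * √C₄ / ε k ≤ √C₄ ^ M →
      dualityGap ω A (lam k) (yt k) (z k M) (v k M) ≤ (ε k : EReal) := by
    intro k M hM hle
    -- After `j + 1` steps the gap has decayed only by `√C₄ ^ j`; this shift is the factor `√C₄` in
    -- `C₅`.
    obtain ⟨j, rfl⟩ : ∃ j, M = j + 1 := ⟨M - 1, by omega⟩
    have h1 : 0 < lam k := by rw [hlam]; exact inv_pos.2 (hLpos k)
    have h2 := (hinner k).dualityGap_le hωc hωK h1 (hκ k) hC4.le (c := C₄) (τmax := τmax)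
      (Lmin := Lmin) (fun j => by
        have h3 := (hinner k).tau_pos j
        have h4 : τ k j * (κmin / τmax) ≤ κmin := by
          rw [mul_div_assoc', div_le_iff₀ hτm, mul_comm]
          exact mul_le_mul_of_nonneg_left (hτ_le k j) hκmin.le
        rw [hC₄, mul_add, mul_one]
        linarith [hκ_le k])
      (hτ_le k) (by rw [hlam]; exact inv_anti₀ hLm (hsched.Lmin_le k)) j
    rw [← hCΨ, ← hClam] at h2
    refine h2.trans (EReal.coe_le_coe ?_)
    have hs : 0 < √C₄ := Real.sqrt_pos.2 (zero_lt_one.trans hC4)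
    rw [div_le_iff₀ (hIAPG.eps_pos k), pow_succ] at hle
    rw [div_le_iff₀ (pow_pos hs j)]
    refine le_of_mul_le_mul_right ?_ hs
    linarith
  have hne : ∀ k, {t : ℕ | dualityGap ω A (lam k) (yt k) (z k t) (v k t) ≤ (ε k : EReal)}.Nonempty := by
    intro k
    obtain ⟨M, hM⟩ := exists_nat_ge (max 1 (2 * Real.log (Clam * √C₄ / ε k) / Real.log C₄))
    have := hIAPG.eps_pos k
    exact ⟨M, hgap k M (by exact_mod_cast (le_max_left _ _).trans hM)
      (le_sqrt_pow_of_log_le hC4 (by positivity) ((le_max_right _ _).trans hM))⟩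
  -- the inner iterations up to an outer iteration `k`
  have hsum : ∀ (k : ℕ) (T X : ℝ), (k : ℝ) ≤ T →
      X = 2 * (2 + p) * Real.log (T * (4 * C₅) ^ (1 / (2 + p))) →
      ∑ l ∈ Finset.range (k + 1), ((sInf {t : ℕ | dualityGap ω A (lam l) (yt l) (z l t) (v l t)
        ≤ (ε l : EReal)} : ℕ) : ℝ) ≤ (1 + (k : ℝ)) *
        (⌈max 1 (max (2 * Real.log C₅ / Real.log C₄) (X / Real.log C₄))⌉₊ : ℝ) := by
    intro k T X hkT hX
    -- One `M` serves every `l ≤ k`: the `C₅` term covers `l = 0`, where the tolerance is `E₀`, and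
    -- the `X` term covers `1 ≤ l ≤ T` through `le_eps`.
    set M := ⌈max 1 (max (2 * Real.log C₅ / Real.log C₄) (X / Real.log C₄))⌉₊ with hM
    have hMle := Nat.le_ceil (max 1 (max (2 * Real.log C₅ / Real.log C₄) (X / Real.log C₄)))
    rw [← hM] at hMle
    have hM1 : 1 ≤ M := by exact_mod_cast (le_max_left _ _).trans hMle
    have hM2 := ((le_max_left _ _).trans (le_max_right _ _)).trans hMle
    have hM3 := ((le_max_right _ _).trans (le_max_right _ _)).trans hMle
    have hbd : ∀ l ∈ Finset.range (k + 1), ((sInf {t : ℕ | dualityGap ω A (lam l) (yt l) (z l t)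
        (v l t) ≤ (ε l : EReal)} : ℕ) : ℝ) ≤ M := by
      intro l hl
      refine Nat.cast_le.2 (Nat.sInf_le (hgap l M hM1 ?_))
      rcases Nat.eq_zero_or_pos l with rfl | hl0
      · rw [hsched.eps_zero]
        refine le_trans ?_ (le_sqrt_pow_of_log_le hC4 hC50 hM2)
        rw [hC₅]
        exact le_mul_of_one_le_right (by positivity) ((one_le_div hLm).2 (hsched.Lmin_le 0))
      · have hl1 : (1 : ℝ) ≤ l := by exact_mod_cast hl0
        have hlT : (l : ℝ) ≤ T :=
          le_trans (by exact_mod_cast Nat.lt_succ_iff.1 (Finset.mem_range.1 hl)) hkT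
        have hT : 0 < T := by linarith
        have h1 := hsched.le_eps hα hIAPG.rho_nonneg hl0
        have h2 : Clam * √C₄ / ε l ≤ 4 * C₅ * T ^ (2 + p) := by
          calc _ ≤ Clam * √C₄ / (E₀ * (Lmin / Ls 0) / (4 * (l : ℝ) ^ (2 + p))) := by gcongr
            _ = 4 * C₅ * (l : ℝ) ^ (2 + p) := by rw [hC₅]; field_simp
            _ ≤ _ := by gcongr
        refine h2.trans (le_sqrt_pow_of_log_le hC4 (by positivity) ?_)
        -- If `C₅ = 0` the quantity to be dominated vanishes; otherwise its logarithm splits as in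
        -- `X`.
        rcases hC50.eq_or_lt with h0 | h0
        · rw [← h0]; simp
        · rw [hX, mul_assoc, log_mul_rpow_inv hT (by positivity) (by positivity)] at hM3
          exact hM3
    calc _ ≤ ∑ l ∈ Finset.range (k + 1), (M : ℝ) := Finset.sum_le_sum hbd
      _ = _ := by rw [Finset.sum_const, Finset.card_range, nsmul_eq_mul]; push_cast; ring
  have hsum_inv : ∀ a e : ℝ, 0 < e →
      ∑ l ∈ Finset.range (⌈a / e⌉₊ + 1), ((sInf {t : ℕ | dualityGap ω A (lam l) (yt l) (z l t)
        (v l t) ≤ (ε l : EReal)} : ℕ) : ℝ) ≤ (1 + (⌈a / e⌉₊ : ℝ)) *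
        (⌈max 1 (max (2 * Real.log C₅ / Real.log C₄)
          (2 * (2 + p) * Real.log (max 1 (2 / e) * ((⌈a⌉₊ : ℝ) * (4 * C₅) ^ (1 / (2 + p))))
            / Real.log C₄))⌉₊ : ℝ) := by
    intro a e he
    refine hsum _ (⌈a⌉₊ * max 1 (2 / e)) _ ?_ ?_
    · rw [div_eq_mul_inv, div_eq_mul_inv]
      exact natCeil_mul_le (by positivity)
    · congr 2
      ring
  have hO_inv : ∀ a C : ℝ, 0 ≤ a → (fun e : ℝ => (1 + (⌈a / e⌉₊ : ℝ)) *
        (⌈max 1 (max (2 * Real.log C₅ / Real.log C₄)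
          (2 * (2 + p) * Real.log (max 1 (2 / e) * C) / Real.log C₄))⌉₊ : ℝ))
        =O[𝓝[>] 0] fun e => e⁻¹ * Real.log (1 / e) := by
    intro a C ha
    refine IsBigO.mul ?_ (natCeil_max_isBigO two_pos)
    simpa only [Real.rpow_neg_one] using one_add_natCeil_isBigO (q := fun e => a / e)
      zero_le_one ha fun e _ => by rw [Real.rpow_neg_one, div_eq_mul_inv]
  have hres : ∀ k : ℕ, 1 ≤ k → ‖x k - y k‖ ≤ 4 * C₃ * √(Lmax / Lmin) / k := fun k hk =>
    hC₃ ▸ hIAPG.norm_x_sub_y_le hf hg hF hxbar hLs hsched hk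
  refine ⟨fun k => sInf {t : ℕ | dualityGap ω A (lam k) (yt k) (z k t) (v k t) ≤ (ε k : EReal)},
    fun k => ⟨Nat.sInf_mem (hne k), fun t ht => Nat.sInf_le ht⟩, ⟨fun e he => ?_, ?_⟩,
    ⟨fun e he => ?_, ?_⟩, ⟨fun e he => ?_, ?_⟩⟩
  · have hq : 0 < √C₂ * e ^ (-(1 / 2) : ℝ) / C₁ := by positivity
    -- The index at which the rate `(√C₂ / (C₁ k)) ^ 2` falls to `e`; it is at least `1` because
    -- `hq` is strict.
    refine ⟨⌈√C₂ * e ^ (-(1 / 2) : ℝ) / C₁⌉₊, ?_, ?_⟩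
    · have hk := Nat.ceil_pos.2 hq
      have hk' := Nat.le_ceil (√C₂ * e ^ (-(1 / 2) : ℝ) / C₁)
      have h1 := hIAPG.value_le (xbar := xbar) hf hg hF hLs hsched hk
      rw [← hC₁, ← hC₂] at h1
      generalize (⌈√C₂ * e ^ (-(1 / 2) : ℝ) / C₁⌉₊) = k at *
      have hk0 : (0 : ℝ) < k := by exact_mod_cast hk
      refine h1.trans ?_
      have h2 : √C₂ / (C₁ * k) ≤ √e := by
        rw [div_le_iff₀ hC1, Real.rpow_neg he.le, ← Real.sqrt_eq_rpow, ← div_eq_mul_inv,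
          div_le_iff₀ (Real.sqrt_pos.2 he)] at hk'
        rw [div_le_iff₀ (by positivity)]
        linarith
      calc _ ≤ √e ^ 2 := by gcongr
        _ = e := Real.sq_sqrt he.le
    · rw [hN₁]
      refine hsum _ (⌈√C₂ / C₁⌉₊ * max 1 (2 * e ^ (-(1 / 2) : ℝ))) _ ?_ ?_
      · rw [mul_div_right_comm]
        exact natCeil_mul_le (by positivity)
      · rw [hC₆, log_max_mul_sq he (by positivity)]
        ring
  · rw [funext hN₁]
    refine IsBigO.mul ?_ (natCeil_max_isBigO four_pos)
    exact one_add_natCeil_isBigO (a := √C₂ / C₁) (by norm_num) (by positivity) fun e _ => by ring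
  · have hq : 0 < 4 * C₃ * √(Lmax / Lmin) / e := by positivity
    refine ⟨⌈4 * C₃ * √(Lmax / Lmin) / e⌉₊, ?_, ?_⟩
    · refine (hres _ (Nat.ceil_pos.2 hq)).trans ?_
      rw [div_le_comm₀ (Nat.cast_pos.2 (Nat.ceil_pos.2 hq)) he]
      exact Nat.le_ceil _
    · rw [hN₂, hC₇]
      exact hsum_inv _ e he
  · rw [funext hN₂]
    exact hO_inv _ _ (by positivity)
  · have hL := hf.nonneg
    have hq : 0 < 4 * C₃ * √(Lmax / Lmin) * (L + Lmax) / e := by positivity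
    refine ⟨⌈4 * C₃ * √(Lmax / Lmin) * (L + Lmax) / e⌉₊, ?_, ?_⟩
    · have hk := Nat.ceil_pos.2 hq
      have hk' := Nat.le_ceil (4 * C₃ * √(Lmax / Lmin) * (L + Lmax) / e)
      generalize (⌈4 * C₃ * √(Lmax / Lmin) * (L + Lmax) / e⌉₊) = k at *
      have hk0 : (0 : ℝ) < k := by exact_mod_cast hk
      -- The extended distance to an empty set is `⊤`, so this finite bound also shows that the
      -- subdifferential is nonempty.
      have h1 := (hIAPG.x_inexact k).infEDist_le hf hF (hLs k ▸ (hLpos k).le)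
      refine h1.trans (ENNReal.ofReal_le_ofReal ?_)
      rw [← hLs]
      calc (L + Ls k) * ‖x k - y k‖ ≤ (L + Lmax) * (4 * C₃ * √(Lmax / Lmin) / k) := by
            gcongr
            · exact hsched.le_Lmax k
            · exact hres k hk
        _ = 4 * C₃ * √(Lmax / Lmin) * (L + Lmax) / k := by ring
        _ ≤ e := by rwa [div_le_comm₀ hk0 he]
    · rw [hN₃, hC₈]
      exact hsum_inv _ e he
  · rw [funext hN₃]
    have := hf.nonneg
    exact hO_inv _ _ (by positivity)
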